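/- Fix $\alpha\in(1,2)$. Let $L=(L_t)_{t\ge0}$ be the spectrally positive $\alpha$-stable Lévy process with $\mathbb E[e^{-\lambda L_t}]=e^{t\lambda^{\alpha}}$ for $\lambda,t\ge0$, and let $p$ be the continuous probability density function of $L_1$. Let $\sigma=(\sigma_t)_{t\ge0}$ be an increasing Lévy process with $\mathbb E[e^{-\lambda\sigma_t}]=e^{-t\alpha\lambda^{\alpha-1}}$ for $\lambda,t\ge0$, and put $$M_t=\exp\Big(\int_0^t\sigma_s\,ds\Big)\frac{p(-\sigma_t)}{p(0)},\qquad t\ge0.$$ Let $\widetilde\sigma=(\widetilde\sigma_t)_{t\ge0}$ be a càdlàg process such that, for every $t\ge0$ and every bounded measurable functional $F$ of paths on $[0,t]$, $$\mathbb E\big[F((\widetilde\sigma_s)_{s\le t})\big]=\mathbb E\big[M_t\,F((\sigma_s)_{s\le t})\big].$$ Conditionally given $\widetilde\sigma$, let $Y_1<Y_2<\cdots$ be the jump times of an inhomogeneous Poisson process on $[0,\infty)$ with intensity $\widetilde\sigma_t\,dt$ (the cut points of the line-breaking construction with intensity process $\widetilde\sigma$), where $Y_k=\infty$ if there are fewer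 than $k$ jumps. Then the first cut time $Y_1$ is almost surely finite and $$\alpha Y_1\sim\mathrm{ML}\Big(1-\frac1\alpha,\,1-\frac1\alpha\Big).$$ Here, for $\beta\in(0,1)$ and $\theta>0$, the generalised Mittag-Leffler distribution $\mathrm{ML}(\theta,\beta)$ is the law on $[0,\infty)$ determined by its moments: $X\sim\mathrm{ML}(\theta,\beta)$ if $X\ge0$ almost surely and $$\mathbb E[X^n]=\frac{\Gamma(\theta)\,\Gamma(\theta/\beta+n)}{\Gamma(\theta/\beta)\,\Gamma(\theta+n\beta)},\qquad n\ge1.$$ -/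

import Mathlib

open MeasureTheory ProbabilityTheory Filter Topology Set
open scoped NNReal ENNReal

noncomputable section

namespace LineBreaking

/-- A path on `[0, ∞)` is càdlàg: right-continuous with left limits. At time `0` the left filter is
trivial, so the second condition is void there. -/
def IsCadlag (f : ℝ≥0 → ℝ) : Prop :=
  ∀ t, ContinuousWithinAt f (Ici t) t ∧ ∃ l, Tendsto f (𝓝[<] t) (𝓝 l)

/-- A real-valued Lévy process: it starts from `0`, has independent and stationary increments, and
almost surely càdlàg paths. -/
structure IsLevyProcess {Ω : Type*} [MeasurableSpace Ω] (X : ℝ≥0 → Ω → ℝ) (P : Measure Ω) :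
    Prop where
  measurable : ∀ t, Measurable (X t)
  zero : ∀ᵐ ω ∂P, X 0 ω = 0
  indep_increments : HasIndepIncrements X P
  stationary_increments : ∀ s t, IdentDistrib (fun ω => X (s + t) ω - X s ω) (X t) P P
  cadlag : ∀ᵐ ω ∂P, IsCadlag fun t => X t ω

/-- `L` is the spectrally positive `α`-stable Lévy process with
`E[exp (-u L_t)] = exp (t u ^ α)` for `u, t ≥ 0`. (This Laplace transform determines the law of `L`;
it forces stability and the absence of negative jumps. As the right-hand side is not zero, the
equation includes integrability of `exp (-u L_t)`.) -/
structure IsStableProcess {Ω : Type*} [MeasurableSpace Ω] (α : ℝ) (L : ℝ≥0 → Ω → ℝ)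
    (P : Measure Ω) : Prop where
  levy : IsLevyProcess L P
  laplace : ∀ (t : ℝ≥0) (u : ℝ), 0 ≤ u →
    ∫ ω, Real.exp (-u * L t ω) ∂P = Real.exp (t * u ^ α)

/-- `p` is the (continuous version of the) probability density function of the random
variable `X`. -/
structure IsContinuousDensity {Ω : Type*} [MeasurableSpace Ω] (p : ℝ → ℝ) (X : Ω → ℝ)
    (P : Measure Ω) : Prop where
  continuous : Continuous p
  nonneg : ∀ x, 0 ≤ p x
  map_eq : P.map X = volume.withDensity fun x => ENNReal.ofReal (p x)

/-- `σ` is an increasing Lévy process with `E[exp (-u σ_t)] = exp (-t α u ^ (α - 1))` for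
`u, t ≥ 0`, i.e. (a multiple of) an `(α - 1)`-stable subordinator. -/
structure IsStableSubordinator {Ω : Type*} [MeasurableSpace Ω] (α : ℝ) (σ : ℝ≥0 → Ω → ℝ)
    (P : Measure Ω) : Prop where
  levy : IsLevyProcess σ P
  monotone : ∀ᵐ ω ∂P, Monotone fun t => σ t ω
  laplace : ∀ (t : ℝ≥0) (u : ℝ), 0 ≤ u →
    ∫ ω, Real.exp (-u * σ t ω) ∂P = Real.exp (-(t * α * u ^ (α - 1)))

/-- `∫_s^t τ_r dr`, for the path `τ` indexed by `[0, ∞)`. -/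
def pathIntegral (τ : ℝ≥0 → ℝ) (s t : ℝ≥0) : ℝ :=
  ∫ r in (s : ℝ)..t, τ r.toNNReal

/-- The density process `M_t = exp (∫_0^t σ_s ds) p (-σ_t) / p 0`. -/
def densityProcess {Ω : Type*} (p : ℝ → ℝ) (σ : ℝ≥0 → Ω → ℝ) (t : ℝ≥0) (ω : Ω) : ℝ :=
  Real.exp (pathIntegral (fun s => σ s ω) 0 t) * p (-σ t ω) / p 0

/-- The path of `X` up to time `t`, with the σ-algebra generated by the coordinates on the target. -/
def pathUpTo {Ω : Type*} (X : ℝ≥0 → Ω → ℝ) (t : ℝ≥0) (ω : Ω) : Iic t → ℝ :=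
  fun s => X s ω

/-- `σ'` (on a space with measure `P'`) is a càdlàg process whose law up to each time `t` is that of
`σ` (on a space with measure `P`) reweighted by the density `M_t`; equivalently
`E'[F ((σ'_s)_{s ≤ t})] = E[M_t F ((σ_s)_{s ≤ t})]` for all bounded measurable `F`. -/
structure IsMeasureChange {Ω Ω' : Type*} [MeasurableSpace Ω] [MeasurableSpace Ω'] (p : ℝ → ℝ)
    (σ : ℝ≥0 → Ω → ℝ) (P : Measure Ω) (σ' : ℝ≥0 → Ω' → ℝ) (P' : Measure Ω') : Prop where
  measurable : ∀ t, Measurable (σ' t)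
  cadlag : ∀ᵐ ω ∂P', IsCadlag fun t => σ' t ω
  law : ∀ t, P'.map (pathUpTo σ' t) =
    (P.withDensity fun ω => ENNReal.ofReal (densityProcess p σ t ω)).map (pathUpTo σ t)

/-- The σ-algebra generated by the process `τ`. -/
abbrev generatedBy {Ω : Type*} (τ : ℝ≥0 → Ω → ℝ) : MeasurableSpace Ω :=
  ⨆ t, MeasurableSpace.comap (τ t) inferInstance

/-- The number of points of the sequence `y` in `(s, t]`. -/
def countIn (y : ℕ → ℝ≥0∞) (s t : ℝ≥0) : ℕ∞ :=
  {k | (s : ℝ≥0∞) < y k ∧ y k ≤ t}.encard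

/-- `Y 0, Y 1, …` are the cut points of a line-breaking construction with intensity process `τ`
(indexed from `0`, so that `Y 0` is the first cut time): conditionally given `τ`, they are the jump
times, in increasing order, of an inhomogeneous Poisson process on `[0, ∞)` with intensity
`τ_t dt`. Thus, conditionally on `τ`, the numbers of points in consecutive intervals `(t_i, t_{i+1}]`
are independent and Poisson distributed with means `∫_{t_i}^{t_{i+1}} τ_r dr`.
It is not presupposed that there are infinitely many jumps: if there are at most `k`, then
`Y k = ∞`. -/
structure IsCutPointSequence {Ω : Type*} [MeasurableSpace Ω] (τ : ℝ≥0 → Ω → ℝ)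
    (Y : ℕ → Ω → ℝ≥0∞) (P : Measure Ω) : Prop where
  measurable : ∀ k, Measurable (Y k)
  pos : ∀ᵐ ω ∂P, 0 < Y 0 ω
  increasing : ∀ᵐ ω ∂P, ∀ k, Y k ω < Y (k + 1) ω ∨ (Y k ω = ∞ ∧ Y (k + 1) ω = ∞)
  poisson : ∀ (n : ℕ) (t : Fin (n + 1) → ℝ≥0), Monotone t → ∀ j : Fin n → ℕ,
    P⟦{ω | ∀ i : Fin n, countIn (fun k => Y k ω) (t i.castSucc) (t i.succ) = j i} | generatedBy τ⟧
      =ᵐ[P] fun ω => ∏ i : Fin n,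
        Real.exp (-pathIntegral (fun s => τ s ω) (t i.castSucc) (t i.succ)) *
          pathIntegral (fun s => τ s ω) (t i.castSucc) (t i.succ) ^ j i / (j i).factorial

/-- The generalised Mittag-Leffler law `ML(θ, β)` (for `0 < β < 1`, `θ > -β`, `θ ≠ 0`): the
probability measure on `[0, ∞)` with `n`-th moment
`Γ(θ) Γ(θ/β + n) / (Γ(θ/β) Γ(θ + nβ))` for all `n ≥ 1`. -/
structure IsMittagLeffler (θ β : ℝ) (μ : Measure ℝ) : Prop where
  isProbabilityMeasure : IsProbabilityMeasure μ
  nonneg : ∀ᵐ x ∂μ, 0 ≤ x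
  integrable : ∀ n : ℕ, 1 ≤ n → Integrable (fun x => x ^ n) μ
  moment : ∀ n : ℕ, 1 ≤ n → ∫ x, x ^ n ∂μ =
    Real.Gamma θ * Real.Gamma (θ / β + n) / (Real.Gamma (θ / β) * Real.Gamma (θ + n * β))

end LineBreaking

end

/-! Conditionally on the intensity, the first cut time exceeds `t` with probability `exp (-∫_0^t
σ')`. Taking expectations and changing measure cancels the exponential factor of `M_t`, so the tail
of `Y 0` is `E[p (-σ_t)] / p 0` (`IsCutPointSequence.measure_lt`,
`IsMeasureChange.lintegral_exp_neg`). Only this function of `t` is needed: its integrals against `t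
^ m` give the moments of `Y 0`, and the case `m = 0` gives finiteness.

With `z` running over a line `Re z = c > 0`, Fourier inversion writes `p (-x)` as the integral of
`exp (z ^ α) * exp (-z x)` (`density_eq_integral_vline`). Averaging over `x = σ_t` replaces the last
factor by `exp (-α z ^ (α - 1) t)`, and integrating against `t ^ m` leaves `m! / α ^ (m + 1)` times
the integral of `z ^ (-s) * exp (z ^ α)` with `s = (m + 1) (α - 1)`
(`integral_pow_mul_integral_density`). The value `p 0` is the same integral with `s = 0`.

These integrals equal `1 / (α Γ((s - 1) / α + 1))` (`eq_of_integral_cpow_mul_exp_cpow`). Formally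
this is Hankel's formula after `w = z ^ α`, but no bent contour is needed. Scaling the line shows
that the integral of `w ^ (-s) * exp (t w ^ α)` is a constant `A` times `t ^ ((s - 1) / α)`.
Integrating against `exp (-t)` yields `A Γ((s - 1) / α + 1)` on one side and the integral of `w ^
(-s) / (1 - w ^ α)` on the other. The only pole of the latter in the right half-plane is at `1`, and
its residue gives `1 / α`. -/

namespace LineBreaking

/-! ### Powers and their exponentials on vertical lines -/

/-- The vertical line `Re z = c`, parametrised so that Fourier inversion carries no constant. -/
noncomputable def vline (c ξ : ℝ) : ℂ := c + (2 * Real.pi * ξ : ℝ) * Complex.I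

@[simp] lemma vline_re (c ξ : ℝ) : (vline c ξ).re = c := by simp [vline]

@[simp] lemma vline_im (c ξ : ℝ) : (vline c ξ).im = 2 * Real.pi * ξ := by simp [vline]

@[fun_prop]
lemma continuous_vline (c : ℝ) : Continuous (vline c) := by unfold vline; fun_prop

lemma vline_mul (l c ξ : ℝ) : vline (l * c) (l * ξ) = l * vline c ξ := by
  simp [vline]; ring

lemma ne_zero_of_re_pos {z : ℂ} (hz : 0 < z.re) : z ≠ 0 := by
  rintro rfl; simp at hz

lemma mem_slitPlane_of_re_pos {z : ℂ} (hz : 0 < z.re) : z ∈ Complex.slitPlane := Or.inl hz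

lemma vline_ne_zero {c : ℝ} (hc : 0 < c) (ξ : ℝ) : vline c ξ ≠ 0 :=
  ne_zero_of_re_pos (by simpa)

lemma continuous_vline_cpow {c : ℝ} (hc : 0 < c) (s : ℂ) : Continuous fun ξ => vline c ξ ^ s :=
  (continuous_vline c).cpow continuous_const fun ξ => mem_slitPlane_of_re_pos (by simpa)

lemma norm_vline_ge {c : ℝ} (hc : 0 < c) (ξ : ℝ) : min c 1 / 2 * (1 + ‖ξ‖) ≤ ‖vline c ξ‖ := by
  have h1 : c ≤ ‖vline c ξ‖ := by
    simpa using (le_abs_self _).trans (Complex.abs_re_le_norm (vline c ξ))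
  have h2 : ‖ξ‖ ≤ ‖vline c ξ‖ := by
    have h := Complex.abs_im_le_norm (vline c ξ)
    rw [vline_im, abs_mul, abs_of_pos (by positivity : 0 < 2 * Real.pi)] at h
    rw [Real.norm_eq_abs]
    nlinarith [Real.pi_gt_three, abs_nonneg ξ]
  have h3 : min c 1 ≤ c := min_le_left _ _
  have h4 : min c 1 ≤ 1 := min_le_right _ _
  have h5 : 0 ≤ min c 1 := by positivity
  nlinarith [norm_nonneg ξ]

lemma integrable_norm_vline_rpow {c r : ℝ} (hc : 0 < c) (hr : 1 < r) :
    Integrable fun ξ => ‖vline c ξ‖ ^ (-r) := by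
  have h := (integrable_one_add_norm (E := ℝ) (μ := volume) (r := r) (by simpa)).const_mul
    ((min c 1 / 2) ^ (-r))
  refine h.mono' (Continuous.aestronglyMeasurable ?_) (.of_forall fun ξ => ?_)
  · exact (continuous_vline c).norm.rpow_const
      fun ξ => Or.inl (norm_ne_zero_iff.2 (vline_ne_zero hc ξ))
  · rw [Real.norm_of_nonneg (by positivity), ← Real.mul_rpow (by positivity) (by positivity)]
    exact Real.rpow_le_rpow_of_nonpos (by positivity) (norm_vline_ge hc ξ) (by linarith)

/-- The argument of `z ^ b` stays within `b π / 2 ≤ π / 2` of zero. For `b = α - 1 < 1` this keeps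
the exponent of the subordinator in the right half-plane, so that time integrals converge. -/
lemma re_cpow_ge {b : ℝ} (hb₀ : 0 ≤ b) (hb₁ : b ≤ 1) {z : ℂ} (hz : 0 < z.re) :
    Real.cos (b * (Real.pi / 2)) * ‖z‖ ^ b ≤ (z ^ (b : ℂ)).re := by
  rw [Complex.cpow_ofReal_re, mul_comm]
  gcongr
  have h := Complex.abs_arg_lt_pi_div_two_iff.2 (Or.inl hz)
  rw [← Real.cos_abs (z.arg * b), abs_mul, abs_of_nonneg hb₀, mul_comm]
  have h2 : b * |z.arg| ≤ b * (Real.pi / 2) := by gcongr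
  refine Real.cos_le_cos_of_nonneg_of_le_pi (by positivity) ?_ (by linarith)
  nlinarith [Real.pi_pos]

/-- The right half-plane splits at an angle `θ` with `π / 2 < a θ`. Beyond it, `z ^ a` points
strictly to the left, because `a * |arg z|` lies between `a θ` and `π`. Inside the sector `‖z‖` is
at most a multiple of `z.re`, and the first term absorbs everything. -/
lemma re_cpow_le {a : ℝ} (ha₁ : 1 < a) (ha₂ : a < 2) :
    ∃ C > 0, ∃ κ > 0, ∀ z : ℂ, 0 < z.re → (z ^ (a : ℂ)).re ≤ C * z.re ^ a - κ * ‖z‖ ^ a := by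
  have hpi := Real.pi_pos
  obtain ⟨θ, hθ₁, hθ₂⟩ : ∃ θ, Real.pi / (2 * a) < θ ∧ θ < Real.pi / 2 :=
    exists_between (by gcongr; linarith)
  have hθ₀ : 0 < θ := lt_trans (by positivity) hθ₁
  have hcos : 0 < Real.cos θ := Real.cos_pos_of_mem_Ioo ⟨by linarith, hθ₂⟩
  have haθ : Real.pi / 2 < a * θ := by
    rw [div_lt_iff₀ (by positivity)] at hθ₁
    linarith
  have hneg : Real.cos (a * θ) < 0 :=
    Real.cos_neg_of_pi_div_two_lt_of_lt haθ (by nlinarith)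
  refine ⟨(1 + -Real.cos (a * θ)) * (1 / Real.cos θ) ^ a, ?_, -Real.cos (a * θ), by linarith, ?_⟩
  · have : 0 < 1 + -Real.cos (a * θ) := by linarith
    positivity
  intro z hz
  have hnz : 0 < ‖z‖ := norm_pos_iff.2 (ne_zero_of_re_pos hz)
  have harg := Complex.abs_arg_lt_pi_div_two_iff.2 (Or.inl hz)
  rw [mul_assoc, ← Real.mul_rpow (by positivity) hz.le, Complex.cpow_ofReal_re]
  have hpow : 0 < ‖z‖ ^ a := by positivity
  rcases le_or_gt θ |z.arg| with h | h
  · have h1 : Real.cos (z.arg * a) ≤ Real.cos (a * θ) := by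
      rw [← Real.cos_abs (z.arg * a), abs_mul, abs_of_pos (by linarith : 0 < a), mul_comm]
      refine Real.cos_le_cos_of_nonneg_of_le_pi (by positivity) ?_ (by gcongr)
      nlinarith
    have h2 : 0 ≤ (1 + -Real.cos (a * θ)) * (1 / Real.cos θ * z.re) ^ a := by
      have : 0 < 1 + -Real.cos (a * θ) := by linarith
      positivity
    nlinarith
  · have h1 : Real.cos θ ≤ Real.cos z.arg := by
      rw [← Real.cos_abs z.arg]
      exact Real.cos_le_cos_of_nonneg_of_le_pi (abs_nonneg _) (by linarith) h.le
    have h2 : ‖z‖ ≤ 1 / Real.cos θ * z.re := by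
      rw [one_div_mul_eq_div, le_div_iff₀ hcos, ← Complex.norm_mul_cos_arg z]
      gcongr
    have h3 : ‖z‖ ^ a ≤ (1 / Real.cos θ * z.re) ^ a := by gcongr
    have h4 : Real.cos (z.arg * a) ≤ 1 := Real.cos_le_one _
    nlinarith

lemma exp_neg_le_inv {x : ℝ} (hx : 0 < x) : Real.exp (-x) ≤ x⁻¹ := by
  rw [Real.exp_neg]
  exact inv_anti₀ hx (by linarith [Real.add_one_le_exp x])

/-- On a vertical line, `exp (z ^ a)` decays at least as fast as `|z| ^ (-a)`. -/
lemma norm_exp_cpow_vline_le {a c : ℝ} (ha₁ : 1 < a) (ha₂ : a < 2) (hc : 0 < c) :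
    ∃ K > 0, ∀ ξ, ‖Complex.exp (vline c ξ ^ (a : ℂ))‖ ≤ K * ‖vline c ξ‖ ^ (-a) := by
  obtain ⟨C, hC, κ, hκ, h⟩ := re_cpow_le ha₁ ha₂
  refine ⟨Real.exp (C * c ^ a) * κ⁻¹, by positivity, fun ξ => ?_⟩
  have hn : 0 < ‖vline c ξ‖ := norm_pos_iff.2 (vline_ne_zero hc ξ)
  have h1 := h (vline c ξ) (by simpa)
  rw [Complex.norm_exp, mul_assoc, Real.rpow_neg hn.le, ← mul_inv]
  calc _ ≤ Real.exp (C * c ^ a + -(κ * ‖vline c ξ‖ ^ a)) := by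
        gcongr; simpa [sub_eq_add_neg] using h1
    _ ≤ _ := by
        rw [Real.exp_add]
        gcongr
        exact exp_neg_le_inv (by positivity)

lemma integrable_cpow_mul_exp_cpow_vline {a c s : ℝ} (ha₁ : 1 < a) (ha₂ : a < 2) (hc : 0 < c)
    (hs : 0 ≤ s) :
    Integrable fun ξ => vline c ξ ^ (-s : ℂ) * Complex.exp (vline c ξ ^ (a : ℂ)) := by
  obtain ⟨K, hK, h⟩ := norm_exp_cpow_vline_le ha₁ ha₂ hc
  refine ((integrable_norm_vline_rpow hc (r := s + a) (by linarith)).const_mul K).mono'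
    (Continuous.aestronglyMeasurable ?_) (.of_forall fun ξ => ?_)
  · exact (continuous_vline_cpow hc _).mul (continuous_vline_cpow hc _).cexp
  · have hn : 0 < ‖vline c ξ‖ := norm_pos_iff.2 (vline_ne_zero hc ξ)
    rw [norm_mul, ← Complex.ofReal_neg, Complex.norm_cpow_real, neg_add, Real.rpow_add hn]
    calc _ ≤ ‖vline c ξ‖ ^ (-s) * (K * ‖vline c ξ‖ ^ (-a)) := by gcongr; exact h ξ
      _ = _ := by ring

lemma integrable_exp_cpow_vline {a c : ℝ} (ha₁ : 1 < a) (ha₂ : a < 2) (hc : 0 < c) :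
    Integrable fun ξ => Complex.exp (vline c ξ ^ (a : ℂ)) := by
  simpa using integrable_cpow_mul_exp_cpow_vline ha₁ ha₂ hc le_rfl

/-! ### Contour shift and the residue at `1` -/

lemma tendsto_const_mul_rpow_neg {B r : ℝ} (hr : 0 < r) :
    Tendsto (fun T : ℝ => B * T ^ (-r)) atTop (𝓝 0) := by
  simpa using (tendsto_rpow_neg_atTop hr).const_mul B

/-- Shifting the contour to infinity: the integral over a vertical line of a function that is
holomorphic in the right half-plane and decays faster than `1 / |z|` vanishes. -/
lemma integral_vertical_eq_zero {h : ℂ → ℂ} (hd : DifferentiableOn ℂ h {z | 0 < z.re})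
    {B r R : ℝ} (hr : 1 < r) (hB : ∀ z : ℂ, 0 < z.re → R ≤ ‖z‖ → ‖h z‖ ≤ B * ‖z‖ ^ (-r))
    {c : ℝ} (hc : 0 < c) (hi : Integrable fun y : ℝ => h (c + y * Complex.I)) :
    ∫ y : ℝ, h (c + y * Complex.I) = 0 := by
  have hB0 : 0 ≤ |B| := abs_nonneg B
  have hlim := intervalIntegral_tendsto_integral hi tendsto_neg_atTop_atBot tendsto_id
  -- Cauchy's theorem on the rectangle `[c, T] × [-T, T]`: the three sides other than `Re z = c`
  -- have total length at most `4 T`, and `h` is at most `|B| * T ^ (-r)` on them.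
  refine tendsto_nhds_unique hlim (squeeze_zero_norm' ?_
    (tendsto_const_mul_rpow_neg (B := 4 * |B|) (r := r - 1) (by linarith)))
  filter_upwards [eventually_ge_atTop R, eventually_gt_atTop c] with T hTR hTc
  have hT : 0 < T := hc.trans hTc
  have key : ∀ z : ℂ, 0 < z.re → T ≤ ‖z‖ → ‖h z‖ ≤ |B| * T ^ (-r) := fun z hz hzT => by
    refine (hB z hz (hTR.trans hzT)).trans ?_
    calc _ ≤ |B| * ‖z‖ ^ (-r) := by gcongr; exact le_abs_self B
      _ ≤ _ := by
        gcongr ?_ * ?_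
        exact Real.rpow_le_rpow_of_nonpos hT hzT (by linarith)
  have hrect := Complex.integral_boundary_rect_eq_zero_of_differentiableOn h
    ⟨c, -T⟩ ⟨T, T⟩ (hd.mono fun z hz => by
      rw [Complex.mem_reProdIm] at hz
      have := hz.1
      simp only [uIcc_of_le hTc.le] at this
      exact hc.trans_le this.1)
  simp only [smul_eq_mul] at hrect
  have e1 : ‖∫ x : ℝ in c..T, h (x + (-T : ℝ) * Complex.I)‖ ≤ |B| * T ^ (-r) * |T - c| := by
    refine intervalIntegral.norm_integral_le_of_norm_le_const fun x hx => ?_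
    rw [uIoc_of_le hTc.le] at hx
    refine key _ (by simpa using hc.trans hx.1) ?_
    have := Complex.abs_im_le_norm (x + (-T : ℝ) * Complex.I)
    simpa [abs_of_pos hT] using this
  have e2 : ‖∫ x : ℝ in c..T, h (x + T * Complex.I)‖ ≤ |B| * T ^ (-r) * |T - c| := by
    refine intervalIntegral.norm_integral_le_of_norm_le_const fun x hx => ?_
    rw [uIoc_of_le hTc.le] at hx
    refine key _ (by simpa using hc.trans hx.1) ?_
    have := Complex.abs_im_le_norm (x + T * Complex.I)
    simpa [abs_of_pos hT] using this
  have e3 : ‖∫ y : ℝ in (-T)..T, h (T + y * Complex.I)‖ ≤ |B| * T ^ (-r) * |T - -T| := by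
    refine intervalIntegral.norm_integral_le_of_norm_le_const fun x hx => ?_
    refine key _ (by simpa using hT) ?_
    have := Complex.abs_re_le_norm (T + x * Complex.I)
    simpa [abs_of_pos hT] using this
  rw [abs_of_pos (sub_pos.2 hTc)] at e1 e2
  rw [abs_of_pos (by linarith : 0 < T - -T)] at e3
  set J := ∫ y : ℝ in (-T)..T, h (c + y * Complex.I)
  have hJ : Complex.I * J = (∫ x : ℝ in c..T, h (x + (-T : ℝ) * Complex.I))
      - (∫ x : ℝ in c..T, h (x + T * Complex.I))
      + Complex.I * ∫ y : ℝ in (-T)..T, h (T + y * Complex.I) := by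
    linear_combination -hrect
  have hJn : ‖J‖ ≤ |B| * T ^ (-r) * (T - c) + |B| * T ^ (-r) * (T - c)
      + |B| * T ^ (-r) * (T - -T) := by
    have : ‖J‖ = ‖Complex.I * J‖ := by simp
    rw [this, hJ]
    refine (norm_add_le _ _).trans (add_le_add ((norm_sub_le _ _).trans (add_le_add e1 e2)) ?_)
    rwa [norm_mul, Complex.norm_I, one_mul]
  refine hJn.trans ?_
  have hTr : T ^ (-(r - 1)) = T ^ (-r) * T := by
    rw [show -(r - 1) = -r + 1 by ring, Real.rpow_add hT, Real.rpow_one]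
  rw [hTr]
  have : 0 ≤ |B| * T ^ (-r) := by positivity
  nlinarith

lemma integrable_div_sq_add_sq {a : ℝ} (ha : 0 < a) :
    Integrable fun y : ℝ => a / (a ^ 2 + y ^ 2) := by
  have h := (integrable_inv_one_add_sq.comp_div ha.ne').const_mul a⁻¹
  refine h.congr (.of_forall fun y => ?_)
  simp only
  field_simp

lemma integral_div_sq_add_sq {a : ℝ} (ha : 0 < a) :
    ∫ y : ℝ, a / (a ^ 2 + y ^ 2) = Real.pi := by
  have h := Measure.integral_comp_div (fun y : ℝ => (1 + y ^ 2)⁻¹) a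
  rw [integral_univ_inv_one_add_sq, abs_of_pos ha, smul_eq_mul] at h
  rw [← mul_right_inj' ha.ne', ← h, ← integral_const_mul]
  congr 1 with y
  field_simp

/-- Such a `z` would have modulus `1`, and `a < 2` confines `a * arg z` to `(-π, π)`, where the
cosine equals `1` only at `0`. -/
lemma cpow_ne_one_of_re_pos {a : ℝ} (ha₁ : 1 < a) (ha₂ : a < 2) {z : ℂ} (hz : 0 < z.re)
    (hz1 : z ≠ 1) : z ^ (a : ℂ) ≠ 1 := by
  intro h
  have hz0 := ne_zero_of_re_pos hz
  have hn : ‖z‖ = 1 := by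
    have h1 := congrArg norm h
    rw [Complex.norm_cpow_real, norm_one] at h1
    exact (Real.rpow_left_inj (norm_nonneg z) zero_le_one (by linarith : a ≠ 0)).1
      (h1.trans (Real.one_rpow a).symm)
  have harg := Complex.abs_arg_lt_pi_div_two_iff.2 (Or.inl hz)
  have h2 := congrArg Complex.re h
  rw [Complex.cpow_ofReal_re, hn, Real.one_rpow, one_mul, Complex.one_re] at h2
  rw [abs_lt] at harg
  have h3 := (Real.cos_eq_one_iff_of_lt_of_lt (x := z.arg * a)
    (by nlinarith [Real.pi_pos]) (by nlinarith [Real.pi_pos])).1 h2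
  have h4 : z.arg = 0 := by
    rcases mul_eq_zero.1 h3 with h | h
    · exact h
    · linarith
  apply hz1
  rw [← Complex.norm_mul_exp_arg_mul_I z, hn, h4]
  simp

/-- Removing the pole at `1` of `z ^ (-s) / (1 - z ^ a)` leaves a holomorphic function on the right
half-plane. -/
lemma exists_differentiableOn_sub_pole {a s : ℝ} (ha₁ : 1 < a) (ha₂ : a < 2) :
    ∃ h : ℂ → ℂ, DifferentiableOn ℂ h {z | 0 < z.re} ∧ ∀ z : ℂ, 0 < z.re → z ≠ 1 →
      h z = z ^ (-s : ℂ) / (1 - z ^ (a : ℂ)) + (a : ℂ)⁻¹ * (1 / (z - 1) - 1 / (z + 1)) := by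
  have hopen : IsOpen {z : ℂ | 0 < z.re} := isOpen_lt continuous_const Complex.continuous_re
  have hnhds : {z : ℂ | 0 < z.re} ∈ 𝓝 (1 : ℂ) := hopen.mem_nhds (by simp)
  have ha0 : (a : ℂ) ≠ 0 := by exact_mod_cast (by linarith : a ≠ 0)
  have hpow : ∀ w : ℂ, DifferentiableOn ℂ (fun z : ℂ => z ^ w) {z | 0 < z.re} := fun w z hz =>
    (DifferentiableAt.cpow_const differentiableAt_id
      (mem_slitPlane_of_re_pos hz)).differentiableWithinAt
  set D : ℂ → ℂ := dslope (fun z : ℂ => z ^ (a : ℂ)) 1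
  have hD : DifferentiableOn ℂ D {z | 0 < z.re} :=
    (Complex.differentiableOn_dslope hnhds).2 (hpow a)
  have hD1 : D 1 = a := by
    simp only [D, dslope_same]
    have := (hasDerivAt_id (1 : ℂ)).cpow_const (c := (a : ℂ)) (by simp)
    simpa using this.deriv
  have hDz : ∀ z : ℂ, z ≠ 1 → D z = (z - 1)⁻¹ * (z ^ (a : ℂ) - 1) := fun z hz => by
    simp only [D]
    rw [dslope_of_ne _ hz]
    simp [slope_def_module]
  have hDne : ∀ z : ℂ, 0 < z.re → D z ≠ 0 := fun z hz => by
    by_cases h1 : z = 1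
    · rw [h1, hD1]; exact ha0
    · rw [hDz z h1]
      exact mul_ne_zero (inv_ne_zero (sub_ne_zero.2 h1))
        (sub_ne_zero.2 (cpow_ne_one_of_re_pos ha₁ ha₂ hz h1))
  have hz1 : ∀ z : ℂ, 0 < z.re → z + 1 ≠ 0 := fun z hz =>
    ne_zero_of_re_pos (by simp; linarith)
  -- This is `z - 1` times the desired function. The coefficient of `1 / (z + 1)` makes `ψ` vanish
  -- at `1`, so its divided difference there is the required extension.
  set ψ : ℂ → ℂ := fun z => -(z ^ (-s : ℂ) / D z) + 2 * (a : ℂ)⁻¹ / (z + 1)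
  have hψ : DifferentiableOn ℂ ψ {z | 0 < z.re} :=
    ((hpow _).div hD hDne).neg.add
      ((differentiableOn_const _).div (differentiableOn_id.add_const _) hz1)
  have hψ1 : ψ 1 = 0 := by
    simp only [ψ, hD1, Complex.one_cpow]
    field_simp
    norm_num
  refine ⟨dslope ψ 1, (Complex.differentiableOn_dslope hnhds).2 hψ, fun z hz hne => ?_⟩
  have h1 := sub_ne_zero.2 hne
  have h2 := hz1 z hz
  have h3 : z ^ (a : ℂ) - 1 ≠ 0 := sub_ne_zero.2 (cpow_ne_one_of_re_pos ha₁ ha₂ hz hne)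
  have h4 : 1 - z ^ (a : ℂ) ≠ 0 := by rw [← neg_sub]; exact neg_ne_zero.2 h3
  rw [dslope_of_ne _ hne, slope_def_module, hψ1, sub_zero, smul_eq_mul]
  simp only [ψ, hDz z hne]
  rw [← neg_sub 1 (z ^ (a : ℂ))]
  field_simp
  ring

/-- A single pole term decays only like `1 / ‖z‖`; pairing it with `1 / (z + 1)`, holomorphic in the
half-plane, improves this to `8 / ‖z‖ ^ 2`, and `a < 2`. The remaining `2` comes from `‖1 - z ^ a‖ ≥
‖z‖ ^ a / 2`. -/
lemma norm_pole_remainder_le {a s : ℝ} (ha₁ : 1 < a) (ha₂ : a < 2) (hs : 0 ≤ s) {z : ℂ}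
    (hz : 2 ≤ ‖z‖) :
    ‖z ^ (-s : ℂ) / (1 - z ^ (a : ℂ)) + (a : ℂ)⁻¹ * (1 / (z - 1) - 1 / (z + 1))‖
      ≤ 10 * ‖z‖ ^ (-a) := by
  have hz0 : 0 < ‖z‖ := by linarith
  have hza : 2 ≤ ‖z‖ ^ a := by
    calc (2 : ℝ) ≤ ‖z‖ := hz
      _ = ‖z‖ ^ (1 : ℝ) := (Real.rpow_one _).symm
      _ ≤ _ := Real.rpow_le_rpow_of_exponent_le (by linarith) ha₁.le
  have h1 : ‖z ^ (-s : ℂ) / (1 - z ^ (a : ℂ))‖ ≤ 2 * ‖z‖ ^ (-a) := by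
    rw [norm_div, ← Complex.ofReal_neg, Complex.norm_cpow_real]
    have h2 : ‖z‖ ^ a / 2 ≤ ‖1 - z ^ (a : ℂ)‖ := by
      have := norm_sub_norm_le (z ^ (a : ℂ)) 1
      rw [norm_sub_rev, Complex.norm_cpow_real, norm_one] at this
      linarith
    calc _ ≤ 1 / (‖z‖ ^ a / 2) := by
          gcongr
          exact Real.rpow_le_one_of_one_le_of_nonpos (by linarith) (by linarith)
      _ = _ := by rw [Real.rpow_neg hz0.le]; field_simp
  have h3 : ‖1 / (z - 1) - 1 / (z + 1)‖ ≤ 8 * ‖z‖ ^ (-a) := by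
    have e1 : ‖z‖ / 2 ≤ ‖z - 1‖ := by
      have := norm_sub_norm_le z 1
      rw [norm_one] at this
      linarith
    have e2 : ‖z‖ / 2 ≤ ‖z + 1‖ := by
      have := norm_sub_norm_le z (-1)
      rw [norm_neg, norm_one, sub_neg_eq_add] at this
      linarith
    have n1 : z - 1 ≠ 0 := norm_pos_iff.1 (by linarith)
    have n2 : z + 1 ≠ 0 := norm_pos_iff.1 (by linarith)
    have e3 : 1 / (z - 1) - 1 / (z + 1) = 2 / ((z - 1) * (z + 1)) := by
      field_simp
      ring
    rw [e3, norm_div, norm_mul, Complex.norm_ofNat]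
    calc _ ≤ 2 / (‖z‖ / 2 * (‖z‖ / 2)) := by gcongr
      _ = 8 * ‖z‖ ^ (-2 : ℝ) := by
        rw [Real.rpow_neg hz0.le, Real.rpow_two]
        field_simp
        norm_num
      _ ≤ _ := by
        gcongr
        linarith
  refine (norm_add_le _ _).trans ?_
  rw [norm_mul, norm_inv, Complex.norm_real, Real.norm_of_nonneg (by linarith : 0 ≤ a)]
  have h5 : a⁻¹ ≤ 1 := inv_le_one_of_one_le₀ ha₁.le
  have h6 : 0 < a⁻¹ := by positivity
  have := norm_nonneg (1 / (z - 1) - 1 / (z + 1))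
  nlinarith

lemma re_inv_sub_inv (c y : ℝ) :
    (1 / ((c : ℂ) + y * Complex.I - 1) - 1 / ((c : ℂ) + y * Complex.I + 1)).re
      = -((1 - c) / ((1 - c) ^ 2 + y ^ 2) + (1 + c) / ((1 + c) ^ 2 + y ^ 2)) := by
  simp only [one_div, Complex.sub_re, Complex.inv_re, Complex.normSq_apply]
  simp
  rw [← neg_sub 1 c, neg_div, add_comm c 1, ← sq, ← sq]
  ring_nf

lemma integrable_inv_sub_inv {c : ℝ} (hc₀ : 0 < c) (hc₁ : c < 1) :
    Integrable fun y : ℝ =>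
      1 / ((c : ℂ) + y * Complex.I - 1) - 1 / ((c : ℂ) + y * Complex.I + 1) := by
  have n1 : ∀ y : ℝ, (c : ℂ) + y * Complex.I - 1 ≠ 0 := fun y h => by
    have := congrArg Complex.re h
    simp at this
    linarith
  have n2 : ∀ y : ℝ, (c : ℂ) + y * Complex.I + 1 ≠ 0 := fun y h => by
    have := congrArg Complex.re h
    simp at this
    linarith
  refine ((integrable_div_sq_add_sq (sub_pos.2 hc₁)).const_mul (2 / (1 - c))).mono'
    (Continuous.aestronglyMeasurable ?_) (.of_forall fun y => ?_)
  · exact (continuous_const.div (by fun_prop) n1).sub (continuous_const.div (by fun_prop) n2)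
  · have e3 : 1 / ((c : ℂ) + y * Complex.I - 1) - 1 / ((c : ℂ) + y * Complex.I + 1)
        = 2 / (((c : ℂ) + y * Complex.I - 1) * ((c : ℂ) + y * Complex.I + 1)) := by
      have := n1 y
      have := n2 y
      field_simp
      ring
    have h1 : ‖(c : ℂ) + y * Complex.I - 1‖ = √((1 - c) ^ 2 + y ^ 2) := by
      rw [Complex.norm_def, Complex.normSq_apply]
      simp
      ring_nf
    have h2 : √((1 - c) ^ 2 + y ^ 2) ≤ ‖(c : ℂ) + y * Complex.I + 1‖ := by
      rw [Complex.norm_def, Complex.normSq_apply]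
      simp
      refine Real.sqrt_le_sqrt ?_
      nlinarith
    have h3 : 0 < (1 - c) ^ 2 + y ^ 2 := by
      have := sub_pos.2 hc₁
      positivity
    rw [e3, norm_div, norm_mul, Complex.norm_ofNat, h1]
    calc _ ≤ 2 / (√((1 - c) ^ 2 + y ^ 2) * √((1 - c) ^ 2 + y ^ 2)) := by gcongr
      _ = _ := by
        rw [Real.mul_self_sqrt h3.le]
        have := sub_pos.2 hc₁
        field_simp

/-- The line runs between the poles `-1` and `1`, so the real part is minus a sum of two Poisson
kernels, each of mass `π`. -/
lemma integral_re_inv_sub_inv {c : ℝ} (hc₀ : 0 < c) (hc₁ : c < 1) :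
    (∫ y : ℝ, (1 / ((c : ℂ) + y * Complex.I - 1) - 1 / ((c : ℂ) + y * Complex.I + 1))).re
      = -(2 * Real.pi) := by
  have h := integral_re (𝕜 := ℂ) (integrable_inv_sub_inv hc₀ hc₁)
  simp only [RCLike.re_eq_complex_re] at h
  rw [← h]
  simp_rw [re_inv_sub_inv]
  rw [integral_neg, integral_add (integrable_div_sq_add_sq (by linarith))
    (integrable_div_sq_add_sq (by linarith)), integral_div_sq_add_sq (by linarith),
    integral_div_sq_add_sq (by linarith)]
  ring

/-- The residue at `1` of `z ^ (-s) / (1 - z ^ a)`, computed as an integral over a vertical line to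
the left of the pole. -/
lemma integral_vline_cpow_div_one_sub_cpow {a s c : ℝ} (ha₁ : 1 < a) (ha₂ : a < 2) (hs : 0 ≤ s)
    (hc₀ : 0 < c) (hc₁ : c < 1)
    (hi : Integrable fun ξ => vline c ξ ^ (-s : ℂ) / (1 - vline c ξ ^ (a : ℂ))) :
    (∫ ξ, vline c ξ ^ (-s : ℂ) / (1 - vline c ξ ^ (a : ℂ))).re = 1 / a := by
  obtain ⟨h, hd, heq⟩ := exists_differentiableOn_sub_pole (s := s) ha₁ ha₂
  have hpi : (0 : ℝ) < 2 * Real.pi := by positivity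
  set f : ℝ → ℂ := fun y => (c + y * Complex.I) ^ (-s : ℂ) / (1 - (c + y * Complex.I) ^ (a : ℂ))
  set k : ℝ → ℂ := fun y =>
    1 / ((c : ℂ) + y * Complex.I - 1) - 1 / ((c : ℂ) + y * Complex.I + 1)
  have hk : Integrable k := integrable_inv_sub_inv hc₀ hc₁
  have hfv : (fun ξ => vline c ξ ^ (-s : ℂ) / (1 - vline c ξ ^ (a : ℂ)))
      = fun ξ => f (2 * Real.pi * ξ) := rfl
  have hf : Integrable f := by
    rw [hfv] at hi
    exact (integrable_comp_mul_left_iff f hpi.ne').1 hi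
  have hh : (fun y : ℝ => h (c + y * Complex.I)) = fun y => f y + (a : ℂ)⁻¹ * k y := by
    ext y
    refine heq _ (by simpa) fun h1 => ?_
    have := congrArg Complex.re h1
    simp at this
    linarith
  have h0 := integral_vertical_eq_zero hd (B := 10) (R := 2) ha₁ (fun z hz hz2 => by
    have hz1 : z ≠ 1 := by
      rintro rfl
      norm_num at hz2
    rw [heq z hz hz1]
    exact norm_pole_remainder_le ha₁ ha₂ hs hz2) hc₀
    (by rw [hh]; exact hf.add (hk.const_mul _))
  rw [hh, integral_add hf (hk.const_mul _), integral_const_mul] at h0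
  have h1 : (∫ y, f y).re = a⁻¹ * (2 * Real.pi) := by
    have h2 := congrArg Complex.re h0
    rw [Complex.add_re, ← Complex.ofReal_inv, Complex.re_ofReal_mul,
      integral_re_inv_sub_inv hc₀ hc₁, Complex.zero_re] at h2
    linarith
  rw [hfv, Measure.integral_comp_mul_left, abs_of_pos (by positivity), Complex.real_smul,
    Complex.re_ofReal_mul, h1]
  field_simp

/-! ### Gamma integrals with complex rate, and Fubini -/

lemma norm_pow_mul_cexp (m : ℕ) (r : ℂ) {t : ℝ} (ht : 0 ≤ t) :
    ‖(t : ℂ) ^ m * Complex.exp (-(r * t))‖ = t ^ m * Real.exp (-(r.re * t)) := by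
  rw [norm_mul, norm_pow, Complex.norm_real, Real.norm_of_nonneg ht, Complex.norm_exp]
  simp

lemma integrableOn_pow_mul_exp_neg (m : ℕ) {r : ℝ} (hr : 0 < r) :
    IntegrableOn (fun t : ℝ => t ^ m * Real.exp (-(r * t))) (Ioi 0) := by
  have h := integrableOn_rpow_mul_exp_neg_mul_rpow (p := 1) (s := m) (b := r)
    (by linarith [m.cast_nonneg (α := ℝ)]) one_pos hr
  simpa using h

lemma integral_pow_mul_exp_neg (m : ℕ) {r : ℝ} (hr : 0 < r) :
    ∫ t : ℝ in Ioi 0, t ^ m * Real.exp (-(r * t)) = m.factorial / r ^ (m + 1) := by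
  have h := Real.integral_rpow_mul_exp_neg_mul_Ioi (a := m + 1) (by positivity) hr
  rw [Real.Gamma_nat_eq_factorial] at h
  simp only [add_sub_cancel_right, Real.rpow_natCast] at h
  rw [h, ← Nat.cast_succ, Real.rpow_natCast]
  simp [div_eq_inv_mul]

lemma integrableOn_pow_mul_cexp_neg (m : ℕ) {r : ℂ} (hr : 0 < r.re) :
    IntegrableOn (fun t : ℝ => (t : ℂ) ^ m * Complex.exp (-(r * t))) (Ioi 0) := by
  refine (integrableOn_pow_mul_exp_neg m hr).mono'
    (Continuous.aestronglyMeasurable (by fun_prop)) ?_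
  filter_upwards [ae_restrict_mem measurableSet_Ioi] with t ht
  exact (norm_pow_mul_cexp m r (le_of_lt ht)).le

lemma tendsto_pow_mul_cexp_neg (m : ℕ) {r : ℂ} (hr : 0 < r.re) :
    Tendsto (fun t : ℝ => (t : ℂ) ^ m * Complex.exp (-(r * t))) atTop (𝓝 0) := by
  rw [tendsto_zero_iff_norm_tendsto_zero]
  have h := (Real.tendsto_pow_mul_exp_neg_atTop_nhds_zero m).comp
    (tendsto_id.const_mul_atTop hr)
  have h2 := h.const_mul ((r.re ^ m)⁻¹)
  rw [mul_zero] at h2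
  refine h2.congr' ?_
  filter_upwards [eventually_ge_atTop 0] with t ht
  rw [norm_pow_mul_cexp m r ht]
  simp only [Function.comp_apply, id, mul_pow]
  field_simp

lemma integral_pow_mul_cexp_neg (m : ℕ) {r : ℂ} (hr : 0 < r.re) :
    ∫ t : ℝ in Ioi 0, (t : ℂ) ^ m * Complex.exp (-(r * t)) = m.factorial / r ^ (m + 1) := by
  have hr0 := ne_zero_of_re_pos hr
  induction m with
  | zero =>
    have h := integral_exp_mul_complex_Ioi (a := -r) (by simpa using hr) 0
    simp only [pow_zero, one_mul]
    simp only [neg_mul] at h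
    rw [h]
    simp
  | succ m ih =>
    have hexp : ∀ t : ℝ, HasDerivAt (fun t : ℝ => Complex.exp (-(r * t)))
        (Complex.exp (-(r * t)) * -r) t := fun t => by
      have h1 : HasDerivAt (fun z : ℂ => -(r * z)) (-r) (t : ℂ) :=
        ((hasDerivAt_id (t : ℂ)).const_mul r).fun_neg.congr_deriv (by simp)
      exact h1.cexp.comp_ofReal
    have hpow : ∀ t : ℝ, HasDerivAt (fun t : ℝ => (t : ℂ) ^ (m + 1))
        ((m + 1 : ℕ) * (t : ℂ) ^ m) t := fun t =>
      ((hasDerivAt_pow (m + 1) (t : ℂ)).comp_ofReal).congr_deriv (by simp)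
    have i1 := (integrableOn_pow_mul_cexp_neg m hr).const_mul ((m + 1 : ℕ) : ℂ)
    have i2 := (integrableOn_pow_mul_cexp_neg (m + 1) hr).const_mul r
    have hF := integral_Ioi_of_hasDerivAt_of_tendsto
      (f := fun t : ℝ => (t : ℂ) ^ (m + 1) * Complex.exp (-(r * t)))
      (f' := fun t : ℝ => (m + 1 : ℕ) * ((t : ℂ) ^ m * Complex.exp (-(r * t)))
        - r * ((t : ℂ) ^ (m + 1) * Complex.exp (-(r * t)))) (a := 0)
      (Continuous.continuousWithinAt (by fun_prop))
      (fun t _ => ((hpow t).mul (hexp t)).congr_deriv (by ring)) (i1.sub i2)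
      (tendsto_pow_mul_cexp_neg (m + 1) hr)
    rw [integral_sub i1 i2, integral_const_mul, integral_const_mul, ih] at hF
    simp only [Complex.ofReal_zero, ne_eq, Nat.add_eq_zero_iff, one_ne_zero, and_false,
      not_false_eq_true, zero_pow, zero_mul, sub_zero] at hF
    rw [sub_eq_zero] at hF
    rw [← mul_right_inj' hr0, ← hF, Nat.factorial_succ]
    push_cast
    field_simp
    ring

/-- Exchange of a Laplace-type integral in `t` with an integral over a parameter. -/
lemma integral_pow_mul_integral_cexp {q r : ℝ → ℂ} (hq : Continuous q) (hr : Continuous r)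
    (hpos : ∀ ξ, 0 < (r ξ).re) (m : ℕ) (hi : Integrable fun ξ => ‖q ξ‖ / (r ξ).re ^ (m + 1)) :
    IntegrableOn (fun t : ℝ => (t : ℂ) ^ m * ∫ ξ, q ξ * Complex.exp (-(r ξ * t))) (Ioi 0) ∧
    ∫ t : ℝ in Ioi 0, (t : ℂ) ^ m * ∫ ξ, q ξ * Complex.exp (-(r ξ * t))
      = m.factorial * ∫ ξ, q ξ / r ξ ^ (m + 1) := by
  set G : ℝ → ℝ → ℂ := fun t ξ => q ξ * ((t : ℂ) ^ m * Complex.exp (-(r ξ * t))) with hG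
  have hGi : Integrable (Function.uncurry G) ((volume.restrict (Ioi 0)).prod volume) := by
    rw [integrable_prod_iff' (Continuous.aestronglyMeasurable (by
      simp only [hG, Function.uncurry_def]; fun_prop))]
    refine ⟨.of_forall fun ξ => (integrableOn_pow_mul_cexp_neg m (hpos ξ)).const_mul (q ξ), ?_⟩
    refine (hi.const_mul (m.factorial : ℝ)).congr (.of_forall fun ξ => ?_)
    simp only [hG, Function.uncurry_apply_pair]
    rw [setIntegral_congr_fun (g := fun t => ‖q ξ‖ * (t ^ m * Real.exp (-((r ξ).re * t))))
      measurableSet_Ioi (fun t ht => by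
        simp only [norm_mul (q ξ)]
        rw [norm_pow_mul_cexp m _ (le_of_lt ht)]), integral_const_mul,
      integral_pow_mul_exp_neg m (hpos ξ)]
    ring
  have hGt : (fun t : ℝ => (t : ℂ) ^ m * ∫ ξ, q ξ * Complex.exp (-(r ξ * t)))
      = fun t => ∫ ξ, G t ξ := by
    ext t
    rw [← integral_const_mul]
    congr 1 with ξ
    simp only [hG]
    ring
  constructor
  · rw [hGt]
    exact hGi.integral_prod_left
  · rw [hGt, integral_integral_swap hGi, ← integral_const_mul]
    congr 1 with ξ
    simp only [hG]
    rw [integral_const_mul, integral_pow_mul_cexp_neg m (hpos ξ)]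
    ring

/-! ### The Hankel-type integral of `z ^ (-s) * exp (z ^ a)` -/

lemma ofReal_mul_cpow {l : ℝ} (hl : 0 < l) {z : ℂ} (hz : z ≠ 0) (w : ℂ) :
    ((l : ℂ) * z) ^ w = (l : ℂ) ^ w * z ^ w := by
  have hl0 : (l : ℂ) ≠ 0 := by exact_mod_cast hl.ne'
  rw [Complex.cpow_def_of_ne_zero (mul_ne_zero hl0 hz), Complex.cpow_def_of_ne_zero hl0,
    Complex.cpow_def_of_ne_zero hz, Complex.log_ofReal_mul hl hz, ← Complex.ofReal_log hl.le,
    add_mul, Complex.exp_add]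

/-- If the integral of `z ^ (-s) * exp (z ^ a)` over the line `Re z = c` does not depend on `c`,
then it is given by Hankel's formula for the Gamma function. -/
lemma eq_of_integral_cpow_mul_exp_cpow {a s A : ℝ} (ha₁ : 1 < a) (ha₂ : a < 2) (hs : 0 ≤ s)
    (hA : ∀ c : ℝ, 0 < c →
      ∫ ξ, vline c ξ ^ (-s : ℂ) * Complex.exp (vline c ξ ^ (a : ℂ)) = A) :
    A = 1 / (a * Real.Gamma ((s - 1) / a + 1)) := by
  have ha0 : 0 < a := by linarith
  obtain ⟨C, hC, κ, hκ, hre⟩ := re_cpow_le ha₁ ha₂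
  -- Small enough for two purposes: `C * c ^ a ≤ 1 / 2` gives `1 - w ^ a` a positive real part, so
  -- the integral in `t` converges, and `c < 1` leaves the pole to the right of the line.
  set c : ℝ := 1 / (2 * (C + 1)) with hcdef
  have hc0 : 0 < c := by positivity
  have hc1 : c < 1 := by
    rw [hcdef, div_lt_one (by positivity)]
    linarith
  have hCc : C * c ^ a ≤ 1 / 2 := by
    have h1 : c ^ a ≤ c := by
      simpa using Real.rpow_le_rpow_of_exponent_ge hc0 hc1.le ha₁.le
    calc C * c ^ a ≤ C * c := by gcongr
      _ ≤ 1 / 2 := by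
        rw [hcdef, mul_one_div, div_le_div_iff₀ (by positivity) (by positivity)]
        linarith
  set w : ℝ → ℂ := vline c
  have hw0 : ∀ ξ, w ξ ≠ 0 := vline_ne_zero hc0
  set q : ℝ → ℂ := fun ξ => w ξ ^ (-s : ℂ)
  set r : ℝ → ℂ := fun ξ => 1 - w ξ ^ (a : ℂ)
  have hq : Continuous q := continuous_vline_cpow hc0 _
  have hr : Continuous r := continuous_const.sub (continuous_vline_cpow hc0 _)
  have hrre : ∀ ξ, κ * ‖w ξ‖ ^ a ≤ (r ξ).re := fun ξ => by
    have := hre (w ξ) (by simpa [w])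
    simp only [w, vline_re] at this
    simp only [r, Complex.sub_re, Complex.one_re]
    linarith
  have hwn : ∀ ξ, 0 < ‖w ξ‖ := fun ξ => norm_pos_iff.2 (hw0 ξ)
  have hrpos : ∀ ξ, 0 < (r ξ).re := fun ξ =>
    lt_of_lt_of_le (by have := hwn ξ; positivity) (hrre ξ)
  have hr0 : ∀ ξ, r ξ ≠ 0 := fun ξ => ne_zero_of_re_pos (hrpos ξ)
  have hi : Integrable fun ξ => ‖q ξ‖ / (r ξ).re ^ (0 + 1) := by
    refine ((integrable_norm_vline_rpow hc0 (r := s + a) (by linarith)).const_mul κ⁻¹).mono'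
      (Continuous.aestronglyMeasurable ?_) (.of_forall fun ξ => ?_)
    · exact hq.norm.div ((Complex.continuous_re.comp hr).pow _)
        fun ξ => pow_ne_zero _ (hrpos ξ).ne'
    · have h0 := hwn ξ
      rw [zero_add, pow_one, Real.norm_of_nonneg (by have := hrpos ξ; positivity)]
      simp only [q]
      rw [← Complex.ofReal_neg, Complex.norm_cpow_real, neg_add, Real.rpow_add h0]
      calc _ ≤ ‖w ξ‖ ^ (-s) / (κ * ‖w ξ‖ ^ a) := by gcongr; exact hrre ξ
        _ = _ := by
          rw [Real.rpow_neg h0.le a]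
          field_simp
  have hi' : Integrable fun ξ => q ξ / r ξ := by
    refine hi.mono' (Continuous.aestronglyMeasurable (hq.div hr hr0)) (.of_forall fun ξ => ?_)
    rw [norm_div, zero_add, pow_one]
    gcongr
    · exact hrpos ξ
    · exact Complex.re_le_norm _
  obtain ⟨-, hlap⟩ := integral_pow_mul_integral_cexp hq hr hrpos 0 hi
  have hres := integral_vline_cpow_div_one_sub_cpow ha₁ ha₂ hs hc0 hc1 hi'
  -- Substituting `z = l w` with `l = t ^ (1 / a)` carries the line `Re w = c` to `Re z = l c`,
  -- where the integral is still `A`.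
  have hscale : ∀ t : ℝ, t ∈ Ioi (0 : ℝ) → (t : ℂ) ^ 0 * ∫ ξ, q ξ * Complex.exp (-(r ξ * t))
      = ((A * (t ^ ((s - 1) / a + 1 - 1) * Real.exp (-(1 * t))) : ℝ) : ℂ) := fun t ht => by
    have ht : 0 < t := ht
    set l : ℝ := t ^ (1 / a)
    have hl : 0 < l := by positivity
    have h1 := hA (l * c) (by positivity)
    have h2 := Measure.integral_comp_mul_left (fun ξ => vline (l * c) ξ ^ (-s : ℂ) *
      Complex.exp (vline (l * c) ξ ^ (a : ℂ))) l
    rw [h1, abs_of_pos (by positivity)] at h2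
    have hla : (l : ℂ) ^ (a : ℂ) = t := by
      rw [← Complex.ofReal_cpow hl.le, ← Real.rpow_mul ht.le, one_div_mul_cancel ha0.ne',
        Real.rpow_one]
    have h3 : ∀ ξ, vline (l * c) (l * ξ) ^ (-s : ℂ) *
        Complex.exp (vline (l * c) (l * ξ) ^ (a : ℂ))
        = ((l ^ (-s) * Real.exp t : ℝ) : ℂ) * (q ξ * Complex.exp (-(r ξ * t))) := fun ξ => by
      rw [vline_mul, ofReal_mul_cpow hl (hw0 ξ), ofReal_mul_cpow hl (hw0 ξ), hla,
        ← Complex.ofReal_neg, ← Complex.ofReal_cpow hl.le]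
      have : (t : ℂ) * w ξ ^ (a : ℂ) = t + -(r ξ * t) := by simp only [r]; ring
      rw [this, Complex.exp_add, Complex.ofReal_mul, Complex.ofReal_exp]
      simp only [q, Complex.ofReal_neg]
      ring
    simp_rw [h3] at h2
    rw [integral_const_mul, Complex.real_smul, ← Complex.ofReal_mul] at h2
    have hne : ((l ^ (-s) * Real.exp t : ℝ) : ℂ) ≠ 0 := by
      exact_mod_cast (by positivity : l ^ (-s) * Real.exp t ≠ 0)
    rw [pow_zero, one_mul, ← mul_right_inj' hne, h2, ← Complex.ofReal_mul]
    congr 1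
    have e1 : l ^ (-s) = t ^ (-s / a) := by
      rw [← Real.rpow_mul ht.le]; congr 1; ring
    have e2 : l⁻¹ = t ^ (-(1 / a)) := by rw [Real.rpow_neg ht.le]
    have e3 : t ^ (-s / a) * t ^ ((s - 1) / a + 1 - 1) = t ^ (-(1 / a)) := by
      rw [← Real.rpow_add ht]; congr 1; field_simp; ring
    have e4 : Real.exp t * Real.exp (-(1 * t)) = 1 := by rw [← Real.exp_add]; simp
    rw [e1, e2, ← e3]
    linear_combination (-t ^ (-s / a) * t ^ ((s - 1) / a + 1 - 1) * A) * e4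
  rw [setIntegral_congr_fun measurableSet_Ioi hscale, integral_complex_ofReal,
    integral_const_mul, Real.integral_rpow_mul_exp_neg_mul_Ioi _ one_pos] at hlap
  · have h5 := congrArg Complex.re hlap
    have hΓ : 0 < Real.Gamma ((s - 1) / a + 1) := Real.Gamma_pos_of_pos (by
      have : -1 < (s - 1) / a := by
        rw [lt_div_iff₀ ha0]; linarith
      linarith)
    simp only [zero_add, pow_one, Nat.factorial_zero, Nat.cast_one, one_mul] at h5
    rw [hres, Complex.ofReal_re] at h5
    simp only [ne_eq, one_ne_zero, not_false_eq_true, div_self, Real.one_rpow, one_mul] at h5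
    rw [eq_div_iff ha0.ne'] at h5
    rw [eq_div_iff (mul_pos ha0 hΓ).ne']
    linarith
  · have : -1 < (s - 1) / a := by
      rw [lt_div_iff₀ ha0]; linarith
    linarith

/-! ### Complex Laplace transforms and Fourier inversion -/

/-- A Laplace transform known on the positive half-line is known on the right half-plane. -/
lemma integral_cexp_neg_mul_eq {Ω : Type*} [MeasurableSpace Ω] {P : Measure Ω} {X : Ω → ℝ}
    {f : ℂ → ℂ} (hf : DifferentiableOn ℂ f {z | 0 < z.re})
    (hint : ∀ u : ℝ, 0 < u → Integrable (fun ω => Real.exp (-u * X ω)) P)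
    (hfu : ∀ u : ℝ, 0 < u → ((∫ ω, Real.exp (-u * X ω) ∂P : ℝ) : ℂ) = f u)
    {z : ℂ} (hz : 0 < z.re) : ∫ ω, Complex.exp (-(z * X ω)) ∂P = f z := by
  have hopen : IsOpen {z : ℂ | 0 < z.re} := isOpen_lt continuous_const Complex.continuous_re
  set Z : Ω → ℝ := fun ω => -X ω
  have hsub : Ioi (0 : ℝ) ⊆ interior (integrableExpSet Z P) := by
    refine interior_maximal (fun u hu => ?_) isOpen_Ioi
    have := hint u hu
    simpa [integrableExpSet, Z] using this
  have hcm : AnalyticOnNhd ℂ (complexMGF Z P) {z | 0 < z.re} :=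
    analyticOnNhd_complexMGF.mono fun w hw => hsub hw
  have hfa : AnalyticOnNhd ℂ f {z | 0 < z.re} := hf.analyticOnNhd hopen
  have hpre : IsPreconnected {z : ℂ | 0 < z.re} := (convex_halfSpace_re_gt 0).isPreconnected
  have hreal : ∀ u : ℝ, 0 < u → complexMGF Z P u = f u := fun u hu => by
    rw [complexMGF_ofReal, ← hfu u hu, mgf]
    simp [Z]
  -- The two analytic functions agree at positive reals, which accumulate at `1`; the identity
  -- theorem does the rest.
  have hseq : ∃ᶠ w in 𝓝[≠] (1 : ℂ), complexMGF Z P w = f w := by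
    have h1 : Tendsto (fun u : ℝ => (u : ℂ)) (𝓝[≠] 1) (𝓝[≠] (1 : ℂ)) := by
      refine tendsto_nhdsWithin_of_tendsto_nhds_of_eventually_within _ ?_ ?_
      · exact (Complex.continuous_ofReal.tendsto' 1 1 (by simp)).mono_left nhdsWithin_le_nhds
      · filter_upwards [self_mem_nhdsWithin] with u hu
        simpa using hu
    refine h1.frequently (Eventually.frequently ?_)
    filter_upwards [nhdsWithin_le_nhds (Ioi_mem_nhds (zero_lt_one (α := ℝ)))] with u hu
    exact hreal u hu
  have h := hcm.eqOn_of_preconnected_of_frequently_eq hfa hpre (z₀ := 1) (by simp) hseq hz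
  rw [← h, complexMGF]
  simp [Z]

/-- The Bochner integral of a non-integrable function is `0` by convention, and an exponential never
is. -/
lemma integrable_of_integral_eq_exp {Ω : Type*} [MeasurableSpace Ω] {P : Measure Ω} {g : Ω → ℝ}
    {x : ℝ} (h : ∫ ω, g ω ∂P = Real.exp x) : Integrable g P :=
  .of_integral_ne_zero (by rw [h]; positivity)

lemma differentiableOn_cpow_re_pos (w : ℂ) :
    DifferentiableOn ℂ (fun z : ℂ => z ^ w) {z | 0 < z.re} := fun _ hz =>
  (DifferentiableAt.cpow_const differentiableAt_id
    (mem_slitPlane_of_re_pos hz)).differentiableWithinAt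

lemma IsStableProcess.integral_cexp {Ω : Type*} [MeasurableSpace Ω] {P : Measure Ω} {α : ℝ}
    {L : ℝ≥0 → Ω → ℝ} (hL : IsStableProcess α L P) {z : ℂ} (hz : 0 < z.re) :
    ∫ ω, Complex.exp (-(z * L 1 ω)) ∂P = Complex.exp (z ^ (α : ℂ)) := by
  refine integral_cexp_neg_mul_eq (f := fun z => Complex.exp (z ^ (α : ℂ)))
    (differentiableOn_cpow_re_pos _).cexp
    (fun u hu => integrable_of_integral_eq_exp (hL.laplace 1 u hu.le)) (fun u hu => ?_) hz
  rw [hL.laplace 1 u hu.le, ← Complex.ofReal_cpow hu.le]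
  simp

lemma IsStableSubordinator.integral_cexp {Ω : Type*} [MeasurableSpace Ω] {P : Measure Ω} {α : ℝ}
    {σ : ℝ≥0 → Ω → ℝ} (hσ : IsStableSubordinator α σ P) (t : ℝ≥0) {z : ℂ} (hz : 0 < z.re) :
    ∫ ω, Complex.exp (-(z * σ t ω)) ∂P = Complex.exp (-(α * z ^ ((α - 1 : ℝ) : ℂ) * t)) := by
  refine integral_cexp_neg_mul_eq
    (f := fun z => Complex.exp (-(α * z ^ ((α - 1 : ℝ) : ℂ) * t)))
    (((differentiableOn_cpow_re_pos _).const_mul _).mul_const _).fun_neg.cexp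
    (fun u hu => integrable_of_integral_eq_exp (hσ.laplace t u hu.le)) (fun u hu => ?_) hz
  rw [hσ.laplace t u hu.le, ← Complex.ofReal_cpow hu.le]
  push_cast
  congr 1
  ring

lemma IsContinuousDensity.integral_comp {Ω : Type*} [MeasurableSpace Ω] {P : Measure Ω}
    {p : ℝ → ℝ} {X : Ω → ℝ} (hp : IsContinuousDensity p X P) (hX : Measurable X) {g : ℝ → ℂ}
    (hg : Continuous g) : ∫ y, p y * g y = ∫ ω, g (X ω) ∂P := by
  rw [← integral_map (f := g) hX.aemeasurable hg.aestronglyMeasurable, hp.map_eq,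
    integral_withDensity_eq_integral_toReal_smul hp.continuous.measurable.ennreal_ofReal
      (.of_forall fun _ => ENNReal.ofReal_lt_top)]
  simp [ENNReal.toReal_ofReal (hp.nonneg _)]

lemma IsContinuousDensity.integrable_comp {Ω : Type*} [MeasurableSpace Ω] {P : Measure Ω}
    {p : ℝ → ℝ} {X : Ω → ℝ} (hp : IsContinuousDensity p X P) (hX : Measurable X) {g : ℝ → ℂ}
    (hg : Continuous g) (hi : Integrable (fun ω => g (X ω)) P) :
    Integrable fun y => p y * g y := by
  have h := (integrable_map_measure (f := X) (g := g) hg.aestronglyMeasurable hX.aemeasurable).2 hi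
  rw [hp.map_eq, integrable_withDensity_iff_integrable_smul'
    hp.continuous.measurable.ennreal_ofReal (.of_forall fun _ => ENNReal.ofReal_lt_top)] at h
  simpa [ENNReal.toReal_ofReal (hp.nonneg _)] using h

/-- Fourier inversion on the line `Re z = c` for the density of a spectrally positive stable
law. -/
lemma density_eq_integral_vline {Ω : Type*} [MeasurableSpace Ω] {P : Measure Ω} {α : ℝ}
    (hα₁ : 1 < α) (hα₂ : α < 2) {L : ℝ≥0 → Ω → ℝ} (hL : IsStableProcess α L P) {p : ℝ → ℝ}
    (hp : IsContinuousDensity p (L 1) P) {c : ℝ} (hc : 0 < c) (x : ℝ) :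
    (p (-x) : ℂ) = ∫ ξ, Complex.exp (vline c ξ ^ (α : ℂ)) * Complex.exp (-(vline c ξ * x)) := by
  -- The tilt by `exp (-c y)` moves the Fourier transform of `p` from the imaginary axis to `Re z =
  -- c`.
  set g : ℝ → ℂ := fun y => p y * Complex.exp (-(c * y))
  have hgc : Continuous g := by
    have := hp.continuous
    fun_prop
  have hgi : Integrable g := by
    refine hp.integrable_comp (hL.levy.measurable 1) (g := fun y => Complex.exp (-(c * y)))
      (by fun_prop) ?_
    have := (integrable_of_integral_eq_exp (hL.laplace 1 c hc.le)).ofReal (𝕜 := ℂ)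
    simpa using this
  have hFg : FourierTransform.fourier g = fun ξ => Complex.exp (vline c ξ ^ (α : ℂ)) := by
    ext ξ
    rw [Real.fourier_real_eq_integral_exp_smul, ← hL.integral_cexp (z := vline c ξ) (by simpa),
      ← hp.integral_comp (hL.levy.measurable 1) (g := fun y => Complex.exp (-(vline c ξ * y)))
        (by fun_prop)]
    congr 1 with y
    simp only [g, smul_eq_mul]
    rw [mul_left_comm, ← Complex.exp_add]
    simp only [vline]
    push_cast
    ring_nf
  have hinv := congrFun (hgc.fourierInv_fourier_eq hgi (by
    rw [hFg]; exact integrable_exp_cpow_vline hα₁ hα₂ hc)) (-x)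
  rw [hFg, Real.fourierInv_eq'] at hinv
  have hne := Complex.exp_ne_zero (-(c * (-x : ℝ)))
  rw [← mul_left_inj' hne]
  have hinv' : (p (-x) : ℂ) * Complex.exp (-(c * (-x : ℝ))) = _ := hinv.symm
  rw [hinv', ← integral_mul_const]
  congr 1 with ξ
  rw [smul_eq_mul, mul_assoc (Complex.exp _), ← Complex.exp_add (-(_ * _)), mul_comm]
  congr 2
  simp [vline]
  ring

/-- The expectation of `p (-σ_t)` as an integral over a vertical line. -/
lemma integral_density_subordinator {Ω₀ Ω : Type*} [MeasurableSpace Ω₀] [MeasurableSpace Ω]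
    {P₀ : Measure Ω₀} {P : Measure Ω} [IsProbabilityMeasure P] {α : ℝ}
    (hα₁ : 1 < α) (hα₂ : α < 2) {L : ℝ≥0 → Ω₀ → ℝ} (hL : IsStableProcess α L P₀) {p : ℝ → ℝ}
    (hp : IsContinuousDensity p (L 1) P₀) {σ : ℝ≥0 → Ω → ℝ} (hσ : IsStableSubordinator α σ P)
    (t : ℝ≥0) {c : ℝ} (hc : 0 < c) :
    Integrable (fun ω => p (-σ t ω)) P ∧
      ((∫ ω, p (-σ t ω) ∂P : ℝ) : ℂ) = ∫ ξ, Complex.exp (vline c ξ ^ (α : ℂ)) *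
        Complex.exp (-(α * vline c ξ ^ ((α - 1 : ℝ) : ℂ) * t)) := by
  set G : Ω → ℝ → ℂ := fun ω ξ =>
    Complex.exp (vline c ξ ^ (α : ℂ)) * Complex.exp (-(vline c ξ * σ t ω))
  have hσm := hσ.levy.measurable t
  have hexp : Measurable fun ξ => Complex.exp (vline c ξ ^ (α : ℂ)) :=
    (continuous_vline_cpow hc _).cexp.measurable
  have hGi : Integrable (Function.uncurry G) (P.prod volume) := by
    have h := (integrable_of_integral_eq_exp (hσ.laplace t c hc.le)).mul_prod
      (integrable_exp_cpow_vline hα₁ hα₂ hc).norm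
    refine h.mono' (Measurable.aestronglyMeasurable ?_) (.of_forall fun x => ?_)
    · have := (continuous_vline c).measurable
      exact (hexp.comp measurable_snd).mul
        (((this.comp measurable_snd).mul
          (Complex.measurable_ofReal.comp (hσm.comp measurable_fst))).neg.cexp)
    · simp only [G, Function.uncurry_def, norm_mul]
      rw [mul_comm, Complex.norm_exp (-_)]
      simp
  have hpG : ∀ ω, (p (-σ t ω) : ℂ) = ∫ ξ, G ω ξ := fun ω =>
    density_eq_integral_vline hα₁ hα₂ hL hp hc _
  constructor
  · have h := hGi.integral_prod_left
    simp only [Function.uncurry_apply_pair, ← hpG] at h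
    simpa using h.re
  · rw [← integral_complex_ofReal]
    simp_rw [hpG]
    rw [integral_integral_swap hGi]
    congr 1 with ξ
    simp only [G]
    rw [integral_const_mul, hσ.integral_cexp t (by simpa)]

/-- The Mellin transform in time of `E[p (-σ_t)]`. -/
lemma integral_pow_mul_integral_density {Ω₀ Ω : Type*} [MeasurableSpace Ω₀] [MeasurableSpace Ω]
    {P₀ : Measure Ω₀} {P : Measure Ω} [IsProbabilityMeasure P] {α : ℝ}
    (hα₁ : 1 < α) (hα₂ : α < 2) {L : ℝ≥0 → Ω₀ → ℝ} (hL : IsStableProcess α L P₀) {p : ℝ → ℝ}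
    (hp : IsContinuousDensity p (L 1) P₀) {σ : ℝ≥0 → Ω → ℝ} (hσ : IsStableSubordinator α σ P)
    (m : ℕ) :
    IntegrableOn (fun t : ℝ => t ^ m * ∫ ω, p (-σ t.toNNReal ω) ∂P) (Ioi 0) ∧
    ∫ t : ℝ in Ioi 0, t ^ m * ∫ ω, p (-σ t.toNNReal ω) ∂P = m.factorial / α ^ (m + 1) *
      (1 / (α * Real.Gamma ((((m + 1 : ℕ) * (α - 1)) - 1) / α + 1))) := by
  have hα0 : 0 < α := by linarith
  have hκ : 0 < Real.cos ((α - 1) * (Real.pi / 2)) := by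
    refine Real.cos_pos_of_mem_Ioo ⟨?_, ?_⟩ <;> nlinarith [Real.pi_pos]
  have main : ∀ c : ℝ, 0 < c →
      IntegrableOn (fun t : ℝ => t ^ m * ∫ ω, p (-σ t.toNNReal ω) ∂P) (Ioi 0) ∧
      ((∫ t : ℝ in Ioi 0, t ^ m * ∫ ω, p (-σ t.toNNReal ω) ∂P : ℝ) : ℂ)
        = m.factorial / α ^ (m + 1) *
          ∫ ξ, vline c ξ ^ (-((m + 1 : ℕ) * (α - 1) : ℝ) : ℂ) *
            Complex.exp (vline c ξ ^ (α : ℂ)) := fun c hc => by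
    set q : ℝ → ℂ := fun ξ => Complex.exp (vline c ξ ^ (α : ℂ))
    set r : ℝ → ℂ := fun ξ => α * vline c ξ ^ ((α - 1 : ℝ) : ℂ)
    have hq : Continuous q := (continuous_vline_cpow hc _).cexp
    have hr : Continuous r := continuous_const.mul (continuous_vline_cpow hc _)
    set b : ℝ := α * (Real.cos ((α - 1) * (Real.pi / 2)) * c ^ (α - 1))
    have hb : 0 < b := by positivity
    have hrb : ∀ ξ, b ≤ (r ξ).re := fun ξ => by
      simp only [r, Complex.re_ofReal_mul, b]
      gcongr
      refine le_trans ?_ (re_cpow_ge (by linarith) (by linarith) (by simpa))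
      gcongr
      simpa using Complex.re_le_norm (vline c ξ)
    have hrpos : ∀ ξ, 0 < (r ξ).re := fun ξ => hb.trans_le (hrb ξ)
    have hi : Integrable fun ξ => ‖q ξ‖ / (r ξ).re ^ (m + 1) := by
      refine ((integrable_exp_cpow_vline hα₁ hα₂ hc).norm.div_const (b ^ (m + 1))).mono'
        (Continuous.aestronglyMeasurable ?_) (.of_forall fun ξ => ?_)
      · exact hq.norm.div ((Complex.continuous_re.comp hr).pow _)
          fun ξ => pow_ne_zero _ (hrpos ξ).ne'
      · have := hrpos ξ
        rw [Real.norm_of_nonneg (by positivity)]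
        gcongr
        exact hrb ξ
    obtain ⟨h1, h2⟩ := integral_pow_mul_integral_cexp hq hr hrpos m hi
    have heq : EqOn (fun t : ℝ => (t : ℂ) ^ m * ∫ ξ, q ξ * Complex.exp (-(r ξ * t)))
        (fun t : ℝ => ((t ^ m * ∫ ω, p (-σ t.toNNReal ω) ∂P : ℝ) : ℂ)) (Ioi 0) := fun t ht => by
      have ht' : ((t.toNNReal : ℝ) : ℂ) = t := by rw [Real.coe_toNNReal t (le_of_lt ht)]
      have h := (integral_density_subordinator hα₁ hα₂ hL hp hσ t.toNNReal hc).2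
      simp only [Complex.ofReal_mul, Complex.ofReal_pow, h]
      congr 3 with ξ
      have ht'' : (t.toNNReal : ℂ) = t := by exact_mod_cast ht'
      simp only [q, r, ht'']
    constructor
    · have h := (h1.congr_fun heq measurableSet_Ioi).re
      simpa only [RCLike.re_eq_complex_re, Complex.ofReal_re, IntegrableOn] using h
    · rw [setIntegral_congr_fun measurableSet_Ioi heq, integral_complex_ofReal] at h2
      rw [h2, div_mul_eq_mul_div, mul_div_assoc, ← integral_div]
      congr 2 with ξ
      have hv := vline_ne_zero hc ξ
      have hpow : (vline c ξ ^ ((α - 1 : ℝ) : ℂ)) ^ (m + 1)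
          = vline c ξ ^ (((m + 1 : ℕ) * (α - 1) : ℝ) : ℂ) := by
        rw [← Complex.cpow_nat_mul]
        push_cast
        rfl
      simp only [q, r]
      rw [mul_pow, hpow, ← Complex.ofReal_neg, Complex.ofReal_neg, Complex.cpow_neg]
      field_simp
  set s : ℝ := (m + 1 : ℕ) * (α - 1)
  refine ⟨(main 1 one_pos).1, ?_⟩
  set I : ℝ := ∫ t : ℝ in Ioi 0, t ^ m * ∫ ω, p (-σ t.toNNReal ω) ∂P
  have hfac : (m.factorial : ℝ) ≠ 0 := by positivity
  -- `I` is defined without reference to `c`, which supplies the required independence of the line.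
  have hA := eq_of_integral_cpow_mul_exp_cpow (A := I * α ^ (m + 1) / m.factorial) (s := s)
    hα₁ hα₂ (by have : 0 < α - 1 := by linarith
                positivity) fun c hc => by
      have h := (main c hc).2
      have hfac' : (m.factorial : ℂ) ≠ 0 := by exact_mod_cast hfac
      have hα0' : (α : ℂ) ≠ 0 := by exact_mod_cast hα0.ne'
      push_cast
      rw [h]
      field_simp
  rw [← hA]
  field_simp

/-- The value at `0` of the density of the spectrally positive stable law. -/
lemma density_zero {Ω : Type*} [MeasurableSpace Ω] {P : Measure Ω} {α : ℝ}
    (hα₁ : 1 < α) (hα₂ : α < 2) {L : ℝ≥0 → Ω → ℝ} (hL : IsStableProcess α L P) {p : ℝ → ℝ}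
    (hp : IsContinuousDensity p (L 1) P) : p 0 = 1 / (α * Real.Gamma (1 - 1 / α)) := by
  have h := eq_of_integral_cpow_mul_exp_cpow (A := p 0) (s := 0) hα₁ hα₂ le_rfl fun c hc => by
    have h := density_eq_integral_vline hα₁ hα₂ hL hp hc 0
    simp only [neg_zero, Complex.ofReal_zero, mul_zero, Complex.exp_zero, mul_one] at h
    simp [h]
  rw [h]
  ring_nf

/-! ### Path integrals as measurable functionals, and the change of measure -/

lemma IsCadlag.exists_abs_le {τ : ℝ≥0 → ℝ} (hτ : IsCadlag τ) (t : ℝ≥0) :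
    ∃ B, ∀ s ≤ t, |τ s| ≤ B := by
  have h : ∃ B, ∀ s ∈ Icc 0 t, |τ s| ≤ B := by
    refine isCompact_Icc.induction_on (p := fun S => ∃ B, ∀ s ∈ S, |τ s| ≤ B) ⟨0, by simp⟩
      (fun S T hST ⟨B, hB⟩ => ⟨B, fun s hs => hB s (hST hs)⟩)
      (fun S T ⟨B, hB⟩ ⟨C, hC⟩ => ⟨max B C, fun s hs => hs.elim
        (fun h => (hB s h).trans (le_max_left _ _)) fun h => (hC s h).trans (le_max_right _ _)⟩)
      fun x _ => ?_
    obtain ⟨hr, l, hl⟩ := hτ x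
    refine ⟨{s | |τ s| ≤ max (|τ x| + 1) (|l| + 1)}, mem_nhdsWithin_of_mem_nhds ?_, _,
      fun s hs => hs⟩
    rw [← nhdsLT_sup_nhdsGE x, mem_sup]
    constructor
    · filter_upwards [hl.abs.eventually_le_const (lt_add_one |l|)] with s hs
      exact hs.trans (le_max_right _ _)
    · filter_upwards [(Tendsto.abs hr).eventually_le_const (lt_add_one |τ x|)] with s hs
      exact hs.trans (le_max_left _ _)
  exact h.imp fun B hB s hs => hB s ⟨zero_le, hs⟩

/-- The point of mesh `1 / (n + 1)` following the `k`-th one, truncated at `t`. -/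
noncomputable def gridPoint (t : ℝ≥0) (n k : ℕ) : Iic t :=
  ⟨min t ((k + 1) / (n + 1)), mem_Iic.2 (min_le_left _ _)⟩

/-- The integral over `[0, t]` of the step function that approximates `x` from the right. -/
noncomputable def stepIntegral (t : ℝ≥0) (n : ℕ) (x : Iic t → ℝ) : ℝ :=
  ∫ r in (0 : ℝ)..t, x (gridPoint t n ⌊(n + 1) * r⌋₊)

/-- Only countably many coordinates enter. The exact path integral is not a priori measurable for
the product σ-algebra on all paths, hence these approximations. -/
lemma measurable_stepIntegral (t : ℝ≥0) (n : ℕ) : Measurable (stepIntegral t n) := by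
  have h : Measurable fun y : (Iic t → ℝ) × ℕ => y.1 (gridPoint t n y.2) :=
    measurable_from_prod_countable_left fun k => measurable_pi_apply (gridPoint t n k)
  have h2 : Measurable fun y : (Iic t → ℝ) × ℝ => y.1 (gridPoint t n ⌊(n + 1) * y.2⌋₊) :=
    h.comp (measurable_fst.prodMk (Nat.measurable_floor.comp (measurable_snd.const_mul _)))
  unfold stepIntegral
  simp_rw [intervalIntegral.integral_of_le t.coe_nonneg]
  exact (h2.stronglyMeasurable.integral_prod_right'
    (ν := volume.restrict (Ioc (0 : ℝ) t))).measurable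

/-- The grid points approach `r` from the right, where càdlàg paths are continuous; truncation at
`t` keeps them within the observed path. -/
lemma tendsto_gridPoint {t : ℝ≥0} {r : ℝ} (hr₀ : 0 ≤ r) (hrt : r ≤ t) :
    Tendsto (fun n : ℕ => (gridPoint t n ⌊(n + 1) * r⌋₊ : ℝ≥0)) atTop
      (𝓝[≥] r.toNNReal) := by
  refine tendsto_nhdsWithin_of_tendsto_nhds_of_eventually_within _ ?_ (.of_forall fun n => ?_)
  · rw [← NNReal.tendsto_coe, Real.coe_toNNReal r hr₀]
    have hlim : Tendsto (fun n : ℕ => r + 1 / ((n : ℝ) + 1)) atTop (𝓝 r) := by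
      simpa using tendsto_one_div_add_atTop_nhds_zero_nat.const_add r
    refine tendsto_of_tendsto_of_tendsto_of_le_of_le tendsto_const_nhds hlim (fun n => ?_)
      fun n => ?_
    · simp only [gridPoint, NNReal.coe_min]
      refine le_min hrt ?_
      push_cast
      rw [le_div_iff₀ (by positivity), mul_comm]
      exact (Nat.lt_floor_add_one _).le
    · simp only [gridPoint, NNReal.coe_min]
      refine (min_le_right _ _).trans ?_
      push_cast
      have hn : (0 : ℝ) < n + 1 := by positivity
      have hfl := Nat.floor_le (mul_nonneg hn.le hr₀)
      rw [div_le_iff₀ hn, add_mul r, one_div_mul_cancel hn.ne', mul_comm r]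
      linarith
  · simp only [mem_Ici, gridPoint]
    rw [← NNReal.coe_le_coe, Real.coe_toNNReal r hr₀, NNReal.coe_min]
    refine le_min hrt ?_
    push_cast
    rw [le_div_iff₀ (by positivity), mul_comm]
    exact (Nat.lt_floor_add_one _).le

lemma IsCadlag.tendsto_stepIntegral {τ : ℝ≥0 → ℝ} (hτ : IsCadlag τ) (t : ℝ≥0) :
    Tendsto (fun n => stepIntegral t n fun s => τ s) atTop (𝓝 (pathIntegral τ 0 t)) := by
  obtain ⟨B, hB⟩ := hτ.exists_abs_le t
  unfold stepIntegral pathIntegral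
  rw [NNReal.coe_zero]
  refine intervalIntegral.tendsto_integral_filter_of_dominated_convergence (fun _ => B)
    (.of_forall fun n => ?_) (.of_forall fun n => .of_forall fun r _ => ?_)
    intervalIntegrable_const (.of_forall fun r hr => ?_)
  · refine Measurable.aestronglyMeasurable ?_
    exact (measurable_from_nat (f := fun k => τ (gridPoint t n k))).comp
      (Nat.measurable_floor.comp (measurable_id.const_mul _))
  · exact hB _ (gridPoint t n _).2
  · rw [uIoc_of_le t.coe_nonneg] at hr
    exact (hτ r.toNNReal).1.tendsto.comp (tendsto_gridPoint hr.1.le hr.2)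

lemma measurable_pathUpTo {Ω : Type*} [MeasurableSpace Ω] {X : ℝ≥0 → Ω → ℝ}
    (hX : ∀ t, Measurable (X t)) (t : ℝ≥0) : Measurable (pathUpTo X t) :=
  measurable_pi_lambda _ fun s => hX s

lemma aemeasurable_pathIntegral {Ω : Type*} [MeasurableSpace Ω] {P : Measure Ω}
    {X : ℝ≥0 → Ω → ℝ} (hX : ∀ t, Measurable (X t)) (hc : ∀ᵐ ω ∂P, IsCadlag fun t => X t ω)
    (t : ℝ≥0) : AEMeasurable (fun ω => pathIntegral (fun s => X s ω) 0 t) P :=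
  aemeasurable_of_tendsto_metrizable_ae atTop
    (fun n => ((measurable_stepIntegral t n).comp (measurable_pathUpTo hX t)).aemeasurable)
    (hc.mono fun _ hω => hω.tendsto_stepIntegral t)

/-- Killing the measure-changed process at rate `σ'` undoes the exponential part of the density. -/
lemma IsMeasureChange.lintegral_exp_neg {Ω Ω' : Type*} [MeasurableSpace Ω] [MeasurableSpace Ω']
    {P : Measure Ω} {P' : Measure Ω'} {p : ℝ → ℝ} {σ : ℝ≥0 → Ω → ℝ} {σ' : ℝ≥0 → Ω' → ℝ}
    (h : IsMeasureChange p σ P σ' P') (hp : Measurable p)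
    (hσ : IsLevyProcess σ P) (t : ℝ≥0) :
    ∫⁻ ω, ENNReal.ofReal (Real.exp (-pathIntegral (fun s => σ' s ω) 0 t)) ∂P'
      = ∫⁻ ω, ENNReal.ofReal (p (-σ t ω) / p 0) ∂P := by
  -- The limsup is measurable on the whole path space and agrees with `exp (-∫_0^t τ)` on càdlàg
  -- paths, so the equality of laws can be applied to it.
  set F : (Iic t → ℝ) → ℝ≥0∞ := fun x =>
    limsup (fun n => ENNReal.ofReal (Real.exp (-stepIntegral t n x))) atTop
  have hF : Measurable F := Measurable.limsup fun n =>
    (measurable_stepIntegral t n).neg.exp.ennreal_ofReal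
  have hFτ : ∀ τ : ℝ≥0 → ℝ, IsCadlag τ →
      F (fun s => τ s) = ENNReal.ofReal (Real.exp (-pathIntegral τ 0 t)) := fun τ hτ =>
    ((ENNReal.continuous_ofReal.comp Real.continuous_exp).tendsto _ |>.comp
      (hτ.tendsto_stepIntegral t).neg).limsup_eq
  clear_value F
  have hD : AEMeasurable (fun ω => ENNReal.ofReal (densityProcess p σ t ω)) P :=
    (((aemeasurable_pathIntegral hσ.measurable hσ.cadlag t).exp.mul
      (hp.comp (hσ.measurable t).neg).aemeasurable).div_const _).ennreal_ofReal
  have hm := measurable_pathUpTo hσ.measurable t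
  calc _ = ∫⁻ ω, F (pathUpTo σ' t ω) ∂P' :=
        lintegral_congr_ae (h.cadlag.mono fun ω hω => (hFτ _ hω).symm)
    _ = ∫⁻ ω, F (pathUpTo σ t ω) ∂(P.withDensity fun ω =>
          ENNReal.ofReal (densityProcess p σ t ω)) := by
        rw [← lintegral_map hF (measurable_pathUpTo h.measurable t), h.law t,
          lintegral_map hF hm]
    _ = ∫⁻ ω, ENNReal.ofReal (densityProcess p σ t ω) * F (pathUpTo σ t ω) ∂P :=
        lintegral_withDensity_eq_lintegral_mul₀ hD (hF.comp hm).aemeasurable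
    _ = _ := by
        refine lintegral_congr_ae (hσ.cadlag.mono fun ω hω => ?_)
        have h1 : F (pathUpTo σ t ω) = _ := hFτ _ hω
        simp only [h1]
        rw [← ENNReal.ofReal_mul' (Real.exp_nonneg _), densityProcess, div_mul_eq_mul_div,
          mul_right_comm, ← Real.exp_add, add_neg_cancel, Real.exp_zero, one_mul]

/-! ### Tail, finiteness and moments of the first cut time -/

/-- The first cut time exceeds `t` with conditional probability `exp (-∫_0^t τ)`. -/
lemma IsCutPointSequence.measure_lt {Ω : Type*} [MeasurableSpace Ω] {P : Measure Ω}
    [IsProbabilityMeasure P] {τ : ℝ≥0 → Ω → ℝ} {Y : ℕ → Ω → ℝ≥0∞}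
    (hY : IsCutPointSequence τ Y P) (hτ : ∀ t, Measurable (τ t)) (t : ℝ≥0) :
    P {ω | (t : ℝ≥0∞) < Y 0 ω}
      = ∫⁻ ω, ENNReal.ofReal (Real.exp (-pathIntegral (fun s => τ s ω) 0 t)) ∂P := by
  have hle : generatedBy τ ≤ (inferInstance : MeasurableSpace Ω) :=
    iSup_le fun s => (hτ s).comap_le
  -- No cut point in `(0, t]`: almost surely the event `t < Y 0`, as the sequence is positive and
  -- nondecreasing.
  set A : Set Ω := {ω | countIn (fun k => Y k ω) 0 t = 0}
  have hAeq : A = {ω | ∀ k, ¬(0 < Y k ω ∧ Y k ω ≤ t)} := by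
    ext ω
    simp [A, countIn, Set.encard_eq_zero, Set.eq_empty_iff_forall_notMem]
  have hA : MeasurableSet A := by
    rw [hAeq]
    simp only [ofPred_forall]
    refine MeasurableSet.iInter fun k => MeasurableSet.compl ?_
    exact (measurableSet_lt measurable_const (hY.measurable k)).inter
      (measurableSet_le (hY.measurable k) measurable_const)
  have hpois : P⟦A | generatedBy τ⟧
      =ᵐ[P] fun ω => Real.exp (-pathIntegral (fun s => τ s ω) 0 t) := by
    have h := hY.poisson 1 ![0, t] (by
      intro i j hij
      fin_cases i <;> fin_cases j <;> simp_all) ![0]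
    simpa [A] using h
  have hYA : {ω | (t : ℝ≥0∞) < Y 0 ω} =ᵐ[P] A := by
    filter_upwards [hY.pos, hY.increasing] with ω h0 hinc
    have hmono : Monotone fun k => Y k ω := monotone_nat_of_le_succ fun k => by
      rcases hinc k with h | ⟨h1, h2⟩
      · exact h.le
      · rw [h1, h2]
    refine propext ?_
    change (t : ℝ≥0∞) < Y 0 ω ↔ ω ∈ A
    rw [hAeq]
    simp only [mem_ofPred_eq, not_and, not_le]
    exact ⟨fun h k _ => h.trans_le (hmono (Nat.zero_le k)), fun h => h 0 h0⟩
  have hint : Integrable (fun ω => Real.exp (-pathIntegral (fun s => τ s ω) 0 t)) P :=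
    integrable_condExp.congr hpois
  rw [measure_congr hYA, ← ofReal_integral_eq_lintegral_ofReal hint
    (.of_forall fun ω => Real.exp_nonneg _), ← integral_congr_ae hpois, integral_condExp hle,
    integral_indicator hA]
  simp [Measure.real]

/-- Moments of a positive random time whose tail is known. -/
lemma moment_toReal_of_tail {Ω : Type*} [MeasurableSpace Ω] {P : Measure Ω}
    [IsProbabilityMeasure P] {Y : Ω → ℝ≥0∞} (hY : Measurable Y) (hfin : ∀ᵐ ω ∂P, Y ω < ∞)
    {S : ℝ → ℝ} (hS : ∀ t, 0 ≤ S t)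
    (htail : ∀ t : ℝ, 0 < t → P {ω | ENNReal.ofReal t < Y ω} = ENNReal.ofReal (S t)) (m : ℕ)
    (hi : IntegrableOn (fun t => t ^ m * S t) (Ioi 0)) :
    Integrable (fun ω => (Y ω).toReal ^ (m + 1)) P ∧
      ∫ ω, (Y ω).toReal ^ (m + 1) ∂P = (m + 1) * ∫ t in Ioi 0, t ^ m * S t := by
  have hnn : 0 ≤ᵐ[volume.restrict (Ioi 0)] fun t => t ^ m * S t := by
    filter_upwards [ae_restrict_mem measurableSet_Ioi] with t ht
    exact mul_nonneg (pow_nonneg (le_of_lt ht) m) (hS t)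
  have hmeas : Measurable fun ω => (Y ω).toReal := hY.ennreal_toReal
  have hlin : ∫⁻ ω, ENNReal.ofReal ((Y ω).toReal ^ (m + 1)) ∂P
      = ENNReal.ofReal ((m + 1) * ∫ t in Ioi 0, t ^ m * S t) := by
    have h := lintegral_rpow_eq_lintegral_meas_lt_mul P (f := fun ω => (Y ω).toReal)
      (.of_forall fun ω => ENNReal.toReal_nonneg) hmeas.aemeasurable (p := (m + 1 : ℕ))
      (by positivity)
    simp only [Real.rpow_natCast] at h
    rw [h, ENNReal.ofReal_mul (by positivity), ofReal_integral_eq_lintegral_ofReal hi hnn]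
    congr 1
    · push_cast; rfl
    · refine setLIntegral_congr_fun measurableSet_Ioi fun t ht => ?_
      have ht : 0 < t := ht
      have h1 : P {ω | t < (Y ω).toReal} = P {ω | ENNReal.ofReal t < Y ω} := by
        refine measure_congr (hfin.mono fun ω hω => propext ?_)
        change t < (Y ω).toReal ↔ ENNReal.ofReal t < Y ω
        exact (ENNReal.ofReal_lt_iff_lt_toReal ht.le hω.ne).symm
      simp only [h1]
      rw [htail t ht, ← ENNReal.ofReal_mul (hS t), mul_comm]
      congr 2
      push_cast
      rw [add_sub_cancel_right, Real.rpow_natCast]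
  have hnnI : 0 ≤ (m + 1) * ∫ t in Ioi 0, t ^ m * S t :=
    mul_nonneg (by positivity) (integral_nonneg_of_ae hnn)
  have hnnY : 0 ≤ᵐ[P] fun ω => (Y ω).toReal ^ (m + 1) := .of_forall fun ω => by positivity
  constructor
  · refine ⟨(hmeas.pow_const _).aestronglyMeasurable, ?_⟩
    rw [hasFiniteIntegral_iff_ofReal hnnY, hlin]
    exact ENNReal.ofReal_lt_top
  · rw [integral_eq_lintegral_of_nonneg_ae hnnY (hmeas.pow_const _).aestronglyMeasurable, hlin,
      ENNReal.toReal_ofReal hnnI]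

/-- A random time with integrable tail is finite. -/
lemma ae_lt_top_of_tail {Ω : Type*} [MeasurableSpace Ω] {P : Measure Ω}
    [IsProbabilityMeasure P] {Y : Ω → ℝ≥0∞} {S : ℝ → ℝ}
    (htail : ∀ t : ℝ, 0 < t → P {ω | ENNReal.ofReal t < Y ω} = ENNReal.ofReal (S t))
    (hi : IntegrableOn S (Ioi 0)) : ∀ᵐ ω ∂P, Y ω < ∞ := by
  -- The tail is bounded below by the mass at `∞`, a constant that is integrable on a half-line only
  -- if it is zero.
  have h : P {ω | Y ω = ∞} * ∞ < ∞ := by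
    calc P {ω | Y ω = ∞} * ∞ = ∫⁻ _ in Ioi (0 : ℝ), P {ω | Y ω = ∞} := by simp
      _ ≤ ∫⁻ t in Ioi (0 : ℝ), ENNReal.ofReal (S t) := by
        refine setLIntegral_mono' measurableSet_Ioi fun t ht => ?_
        rw [← htail t ht]
        refine measure_mono fun ω (hω : Y ω = ∞) => ?_
        simp [hω]
      _ < ∞ := hi.lintegral_lt_top
  have h0 : P {ω | Y ω = ∞} = 0 := by
    by_contra hne
    rw [ENNReal.mul_top hne] at h
    exact lt_irrefl _ h
  rw [ae_iff]
  simpa using h0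

end LineBreaking

/-! ### The Mittag-Leffler moments -/

theorem proposition1p4 (α : ℝ) (hα₁ : 1 < α) (hα₂ : α < 2)
    -- the stable process and the density `p` of `L_1`
    {Ω₀ : Type*} [MeasurableSpace Ω₀] (P₀ : Measure Ω₀) [IsProbabilityMeasure P₀]
    (L : ℝ≥0 → Ω₀ → ℝ) (hL : LineBreaking.IsStableProcess α L P₀)
    (p : ℝ → ℝ) (hp : LineBreaking.IsContinuousDensity p (L 1) P₀)
    -- the subordinator
    {Ω : Type*} [MeasurableSpace Ω] (P : Measure Ω) [IsProbabilityMeasure P]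
    (σ : ℝ≥0 → Ω → ℝ) (hσ : LineBreaking.IsStableSubordinator α σ P)
    -- the measure-changed subordinator, and the cut points with this intensity
    {Ω' : Type*} [MeasurableSpace Ω'] (P' : Measure Ω') [IsProbabilityMeasure P']
    (σ' : ℝ≥0 → Ω' → ℝ) (hσ' : LineBreaking.IsMeasureChange p σ P σ' P')
    (Y : ℕ → Ω' → ℝ≥0∞) (hY : LineBreaking.IsCutPointSequence σ' Y P') :
    (∀ᵐ ω ∂P', Y 0 ω < ∞) ∧
      LineBreaking.IsMittagLeffler (1 - 1 / α) (1 - 1 / α)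
        (P'.map fun ω => α * (Y 0 ω).toReal) := by
  have hα0 : 0 < α := by linarith
  have hβ : 0 < 1 - 1 / α := by
    rw [sub_pos, div_lt_one hα0]
    exact hα₁
  have hΓ : 0 < Real.Gamma (1 - 1 / α) := Real.Gamma_pos_of_pos hβ
  have hp0 := LineBreaking.density_zero hα₁ hα₂ hL hp
  have hp0pos : 0 < p 0 := by
    rw [hp0]
    positivity
  set S : ℝ → ℝ := fun t => (∫ ω, p (-σ t.toNNReal ω) ∂P) / p 0
  have hS : ∀ t, 0 ≤ S t := fun t =>
    div_nonneg (integral_nonneg fun ω => hp.nonneg _) hp0pos.le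
  have htail : ∀ t : ℝ, 0 < t → P' {ω | ENNReal.ofReal t < Y 0 ω} = ENNReal.ofReal (S t) :=
    fun t ht => by
      have hi := (LineBreaking.integral_density_subordinator hα₁ hα₂ hL hp hσ t.toNNReal
        one_pos).1
      rw [ENNReal.ofReal, hY.measure_lt hσ'.measurable,
        hσ'.lintegral_exp_neg hp.continuous.measurable hσ.levy,
        ← ofReal_integral_eq_lintegral_ofReal (hi.div_const _)
          (.of_forall fun ω => div_nonneg (hp.nonneg _) hp0pos.le), integral_div]
  have hmel : ∀ m : ℕ, IntegrableOn (fun t => t ^ m * S t) (Ioi 0) ∧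
      ∫ t in Ioi 0, t ^ m * S t = m.factorial / α ^ (m + 1) *
        (Real.Gamma (1 - 1 / α) / Real.Gamma (1 - 1 / α + (m + 1 : ℕ) * (1 - 1 / α))) :=
    fun m => by
      obtain ⟨h1, h2⟩ :=
        LineBreaking.integral_pow_mul_integral_density hα₁ hα₂ hL hp hσ m
      have heq : (fun t => t ^ m * S t)
          = fun t => (t ^ m * ∫ ω, p (-σ t.toNNReal ω) ∂P) / p 0 := by
        ext t
        exact (mul_div_assoc _ _ _).symm
      have harg : ((m + 1 : ℕ) * (α - 1) - 1) / α + 1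
          = 1 - 1 / α + (m + 1 : ℕ) * (1 - 1 / α) := by
        field_simp
        ring
      have hΓ' : 0 < Real.Gamma (1 - 1 / α + (m + 1 : ℕ) * (1 - 1 / α)) :=
        Real.Gamma_pos_of_pos (by positivity)
      rw [heq]
      refine ⟨h1.div_const _, ?_⟩
      rw [integral_div, h2, hp0, harg]
      field_simp
  have hfin : ∀ᵐ ω ∂P', Y 0 ω < ∞ :=
    LineBreaking.ae_lt_top_of_tail htail (by simpa using (hmel 0).1)
  have hmom : ∀ m : ℕ, Integrable (fun ω => (α * (Y 0 ω).toReal) ^ (m + 1)) P' ∧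
      ∫ ω, (α * (Y 0 ω).toReal) ^ (m + 1) ∂P' = (m + 1).factorial *
        (Real.Gamma (1 - 1 / α) / Real.Gamma (1 - 1 / α + (m + 1 : ℕ) * (1 - 1 / α))) :=
    fun m => by
      obtain ⟨h1, h2⟩ := LineBreaking.moment_toReal_of_tail (hY.measurable 0) hfin hS htail m
        (hmel m).1
      simp_rw [mul_pow]
      refine ⟨h1.const_mul _, ?_⟩
      rw [integral_const_mul, h2, (hmel m).2, Nat.factorial_succ]
      push_cast
      field_simp
  have hmeas : Measurable fun ω => α * (Y 0 ω).toReal :=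
    (hY.measurable 0).ennreal_toReal.const_mul α
  refine ⟨hfin, Measure.isProbabilityMeasure_map hmeas.aemeasurable, ?_, fun n hn => ?_,
    fun n hn => ?_⟩
  · rw [ae_map_iff hmeas.aemeasurable measurableSet_Ici]
    exact .of_forall fun ω => mul_nonneg hα0.le ENNReal.toReal_nonneg
  · obtain ⟨m, rfl⟩ := Nat.exists_eq_add_of_le' hn
    exact (integrable_map_measure (continuous_pow _).aestronglyMeasurable
      hmeas.aemeasurable).2 (hmom m).1
  · obtain ⟨m, rfl⟩ := Nat.exists_eq_add_of_le' hn
    -- Since `θ = β`, the ratio `Γ(θ / β + n) / Γ(θ / β)` is `n!`.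
    rw [integral_map hmeas.aemeasurable (continuous_pow _).aestronglyMeasurable, (hmom m).2,
      div_self hβ.ne', Real.Gamma_one, one_mul, add_comm (1 : ℝ), Real.Gamma_nat_eq_factorial]
    ring
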